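/- \textbf{Setting.} Let $\Sigma$ be a finite set, let $p\in\Delta(\Sigma)$ be a probability vector with $p_u>0$ for all $u\in\Sigma$, let $\varepsilon\ge 0$, and let $G=(G_u)_{u\in\Sigma}$ be a random vector in $\mathbb{R}^{\Sigma}$ with i.i.d.\ coordinates of law $\mathcal{L}$. Write $\mathrm{KL}(r\|p)=\sum_{u} r_u\log\frac{r_u}{p_u}$ and $H(r)=-\sum_u r_u\log r_u$ (with $0\log 0=0$). A \emph{mechanism} is a measurable map $q:\mathbb{R}^\Sigma\to\mathbb{R}^\Sigma$ with $q(G)\in\Delta(\Sigma)$ almost surely; it is \emph{feasible} if $\mathrm{KL}(\mathbb{E}[q(G)]\|p)\le\varepsilon$, and \emph{optimal} if it is feasible and maximizes $\mathbb{E}[G\cdot q(G)]$ among all feasible mechanisms. For $\tau\in\mathbb{R}^\Sigma$ let $M(g,\tau)=\arg\max_{v\in\Sigma}(g_v+\tau_v)$ denote the set of maximizers. A \emph{tie-breaking rule} for $\tau$ is a measurable map $T:\mathbb{R}^\Sigma\to[0,1]^\Sigma$ with $\sum_{u\in M(g,\tau)}T_u(g)=1$ for all $g$, and $q^{\tau,T}$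 denotes the mechanism \[ q^{\tau,T}(g)_u=\begin{cases}1&\text{if } M(g,\tau)=\{u\},\\ T_u(g)&\text{if } u\in M(g,\tau)\text{ and } |M(g,\tau)|>1,\\ 0&\text{otherwise.}\end{cases} \] \textbf{Theorem.} (1) If $\mathcal{L}$ has a finite first moment, there are $\tau\in\mathbb{R}^\Sigma$ and a tie-breaking rule $T$ for $\tau$ such that $q^{\tau,T}$ is optimal. They can be chosen such that, moreover, $\mathrm{KL}(\mathbb{E}[q^{\tau,T}(G)]\|p)=\varepsilon$ unless $q^{0,T}$ with $T$ uniform on $M(g,0)$ is feasible, and such that $\tau=0$ whenever $q^{0,T_0}$ is feasible for some tie-breaking rule $T_0$ for $0$. (2) Suppose that $\mathcal{L}$ is the standard Gumbel law, and for $\alpha\in[0,1]$ put \[ q_\alpha(g)_u=\mathbf{1}\Big\{u\in\arg\max_{v\in\Sigma}\big(g_v+\alpha\log p_v\big)\Big\},\qquad r_\alpha(u)=\frac{p_u^\alpha}{\sum_{v}p_v^\alpha}. \] There is $\alpha\in[0,1]$ such that $q_\alpha$ is optimal, where $\mathrm{KL}(\mathbb{E}[q_\alpha(G)]\|p)=\varepsilon$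 if some value in $[0,1]$ achieves this equality, and $\alpha=0$ otherwise; if $\varepsilon=0$, one can take $\alpha=1$, which gives the AAR/KTH mechanism $\arg\max_v(G_v+\log p_v)$. For the same $\alpha$, $\mathbb{E}[q_\alpha(G)]=r_\alpha$, and $r_\alpha$ is the unique maximizer of $H(r)$ over all $r\in\Delta(\Sigma)$ with $\mathrm{KL}(r\|p)\le\varepsilon$. Furthermore, for every $r\in\Delta(\Sigma)$, \[ \max\big\{\mathbb{E}[G\cdot q(G)] : q \text{ a mechanism with } \mathbb{E}[q(G)]=r\big\}=\gamma+H(r), \] where $\gamma$ is the Euler--Mascheroni constant, so that maximizing over feasible $q$ reduces to maximizing $H(r)$ over $r\in\Delta(\Sigma)$ with $\mathrm{KL}(r\|p)\le\varepsilon$. -/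

import Mathlib

open MeasureTheory ProbabilityTheory Set

noncomputable section

namespace Watermark

variable {V Ω : Type*} [Fintype V] [MeasurableSpace Ω]

/-- The divergence `KL(r‖p) = ∑ u, r u * log (r u / p u)`, with `0 * log 0 = 0`. -/
def kl (r p : V → ℝ) : ℝ := ∑ u, r u * Real.log (r u / p u)

/-- Shannon entropy `H(r) = -∑ u, r u * log (r u)`, with `0 * log 0 = 0`. -/
def entropy (r : V → ℝ) : ℝ := -∑ u, r u * Real.log (r u)

/-- A sampling mechanism for the scores `G`: a measurable map `q` with `q(G)` in the probability
simplex almost surely. -/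
def IsMechanism (P : Measure Ω) (G : Ω → V → ℝ) (q : (V → ℝ) → V → ℝ) : Prop :=
  Measurable q ∧ ∀ᵐ ω ∂P, q (G ω) ∈ stdSimplex ℝ V

/-- The averaged distribution `𝔼[q(G)]`. -/
def mean (P : Measure Ω) (G : Ω → V → ℝ) (q : (V → ℝ) → V → ℝ) : V → ℝ :=
  fun u => ∫ ω, q (G ω) u ∂P

/-- The objective `𝔼[G · q(G)]`. -/
def score (P : Measure Ω) (G : Ω → V → ℝ) (q : (V → ℝ) → V → ℝ) : ℝ :=
  ∫ ω, ∑ u, G ω u * q (G ω) u ∂P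

/-- Mechanisms satisfying the soft constraint `KL(𝔼[q(G)]‖p) ≤ ε`. -/
def IsFeasible (P : Measure Ω) (G : Ω → V → ℝ) (p : V → ℝ) (ε : ℝ)
    (q : (V → ℝ) → V → ℝ) : Prop :=
  IsMechanism P G q ∧ kl (mean P G q) p ≤ ε

/-- Feasible mechanisms attaining the maximum of the objective over all feasible mechanisms. -/
def IsOptimal (P : Measure Ω) (G : Ω → V → ℝ) (p : V → ℝ) (ε : ℝ)
    (q : (V → ℝ) → V → ℝ) : Prop :=
  IsFeasible P G p ε q ∧ ∀ q', IsFeasible P G p ε q' → score P G q' ≤ score P G q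

open Classical in
/-- The set `M(g, τ)` of maximizers of `v ↦ g v + τ v`. -/
def maximizers (g τ : V → ℝ) : Finset V :=
  Finset.univ.filter fun u => ∀ v, g v + τ v ≤ g u + τ u

/-- A measurable tie-breaking rule for `τ`: weights in `[0, 1]` with total mass one on
`M(g, τ)`. -/
def IsTieBreak (τ : V → ℝ) (T : (V → ℝ) → V → ℝ) : Prop :=
  Measurable T ∧ (∀ g u, T g u ∈ Icc (0 : ℝ) 1) ∧ ∀ g, ∑ u ∈ maximizers g τ, T g u = 1

open Classical in
/-- The mechanism that puts all mass on `M(g, τ)`, using the weights `T` when there is a tie. -/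
def argmaxMechanism (τ : V → ℝ) (T : (V → ℝ) → V → ℝ) : (V → ℝ) → V → ℝ := fun g u =>
  if maximizers g τ = {u} then 1
  else if u ∈ maximizers g τ ∧ 1 < (maximizers g τ).card then T g u
  else 0

/-- The tie-breaking rule that is uniform on `M(g, τ)`. -/
def uniformTieBreak (τ : V → ℝ) : (V → ℝ) → V → ℝ :=
  fun g _ => ((maximizers g τ).card : ℝ)⁻¹

/-- The standard Gumbel law: density `exp (-(x + exp (-x)))`. -/
def stdGumbel : Measure ℝ :=
  volume.withDensity fun x => ENNReal.ofReal (Real.exp (-(x + Real.exp (-x))))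

open Classical in
/-- The mechanism `q(g)_u = 1{u ∈ argmax_v (g v + α * log (p v))}`. -/
def gumbelMechanism (p : V → ℝ) (α : ℝ) : (V → ℝ) → V → ℝ := fun g u =>
  if u ∈ maximizers g (fun v => α * Real.log (p v)) then 1 else 0

/-- The distribution proportional to `p ^ α`. -/
def powerDist (p : V → ℝ) (α : ℝ) : V → ℝ := fun u => p u ^ α / ∑ v, p v ^ α

end Watermark

end

namespace Watermark

section Divergence

variable {V : Type*} [Fintype V]

lemma kl_eq_neg_entropy_sub {p : V → ℝ} (hp : ∀ u, 0 < p u) (r : V → ℝ) :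
    kl r p = -entropy r - ∑ u, r u * Real.log (p u) := by
  rw [kl, entropy, neg_neg, ← Finset.sum_sub_distrib]
  refine Finset.sum_congr rfl fun u _ => ?_
  rcases eq_or_ne (r u) 0 with h | h
  · simp [h]
  · rw [Real.log_div h (hp u).ne', mul_sub]

lemma continuous_entropy : Continuous (entropy : (V → ℝ) → ℝ) :=
  (continuous_finsetSum _ fun u _ => Real.continuous_mul_log.comp (continuous_apply u)).neg

lemma continuous_kl {p : V → ℝ} (hp : ∀ u, 0 < p u) : Continuous fun r => kl r p := by
  simp_rw [kl_eq_neg_entropy_sub hp]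
  exact continuous_entropy.neg.sub
    (continuous_finsetSum _ fun u _ => (continuous_apply u).mul continuous_const)

lemma kl_self {p : V → ℝ} (hp : ∀ u, 0 < p u) : kl p p = 0 := by
  simp [kl, div_self (hp _).ne']

lemma sub_lt_mul_log_div {x y : ℝ} (hx : 0 ≤ x) (hy : 0 < y) (hxy : x ≠ y) :
    x - y < x * Real.log (x / y) := by
  rcases hx.eq_or_lt with rfl | hx
  · simpa using hy
  · have h := Real.log_lt_sub_one_of_pos (div_pos hy hx)
      (fun h => hxy ((div_eq_one_iff_eq hx.ne').1 h).symm)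
    have h' : x * (1 - y / x) = x - y := by field_simp
    rw [← h', ← inv_div y x, Real.log_inv]
    exact mul_lt_mul_of_pos_left (by linarith) hx

lemma sub_le_mul_log_div {x y : ℝ} (hx : 0 ≤ x) (hy : 0 < y) : x - y ≤ x * Real.log (x / y) := by
  rcases eq_or_ne x y with rfl | h
  · simp [div_self hy.ne']
  · exact (sub_lt_mul_log_div hx hy h).le

lemma kl_pos {r q : V → ℝ} (hr : r ∈ stdSimplex ℝ V) (hq : q ∈ stdSimplex ℝ V)
    (hq_pos : ∀ u, 0 < q u) (hrq : r ≠ q) : 0 < kl r q := by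
  obtain ⟨u, hu⟩ := Function.ne_iff.1 hrq
  calc (0 : ℝ) = ∑ u, (r u - q u) := by rw [Finset.sum_sub_distrib, hr.2, hq.2, sub_self]
    _ < kl r q := Finset.sum_lt_sum (fun v _ => sub_le_mul_log_div (hr.1 v) (hq_pos v))
        ⟨u, Finset.mem_univ u, sub_lt_mul_log_div (hr.1 u) (hq_pos u) hu⟩

/-- The probability vectors within divergence `ε` of `p`. -/
def klBall (p : V → ℝ) (ε : ℝ) : Set (V → ℝ) := {r | r ∈ stdSimplex ℝ V ∧ kl r p ≤ ε}

lemma convexOn_kl {p : V → ℝ} (hp : ∀ u, 0 < p u) :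
    ConvexOn ℝ (stdSimplex ℝ V) fun r => kl r p := by
  refine ⟨convex_stdSimplex ℝ V, fun x hx y hy a b ha hb hab => ?_⟩
  simp only [kl_eq_neg_entropy_sub hp, entropy, neg_neg, ← Finset.sum_sub_distrib,
    smul_eq_mul, Finset.mul_sum, ← Finset.sum_add_distrib, Pi.add_apply, Pi.smul_apply]
  refine Finset.sum_le_sum fun u _ => ?_
  have := Real.convexOn_mul_log.2 (hx.1 u) (hy.1 u) ha hb hab
  simp only [smul_eq_mul] at this
  linarith

lemma convex_klBall {p : V → ℝ} (hp : ∀ u, 0 < p u) (ε : ℝ) : Convex ℝ (klBall p ε) :=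
  (convexOn_kl hp).convex_le ε

lemma isCompact_klBall {p : V → ℝ} (hp : ∀ u, 0 < p u) (ε : ℝ) : IsCompact (klBall p ε) :=
  (isCompact_stdSimplex ℝ V).inter_right (isClosed_le (continuous_kl hp) continuous_const)

lemma self_mem_klBall {p : V → ℝ} (hp : p ∈ stdSimplex ℝ V) (hp_pos : ∀ u, 0 < p u) {ε : ℝ}
    (hε : 0 ≤ ε) : p ∈ klBall p ε :=
  ⟨hp, (kl_self hp_pos).trans_le hε⟩

lemma nonempty_of_mem_stdSimplex {p : V → ℝ} (hp : p ∈ stdSimplex ℝ V) : Nonempty V := by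
  by_contra h
  rw [not_nonempty_iff] at h
  simpa using hp.2

section PowerDist

variable [Nonempty V] {p : V → ℝ}

lemma sum_rpow_pos (hp : ∀ u, 0 < p u) (α : ℝ) : 0 < ∑ v, p v ^ α :=
  Finset.sum_pos (fun v _ => Real.rpow_pos_of_pos (hp v) α) Finset.univ_nonempty

lemma powerDist_pos (hp : ∀ u, 0 < p u) (α : ℝ) (u : V) : 0 < powerDist p α u :=
  div_pos (Real.rpow_pos_of_pos (hp u) α) (sum_rpow_pos hp α)

lemma powerDist_mem_stdSimplex (hp : ∀ u, 0 < p u) (α : ℝ) : powerDist p α ∈ stdSimplex ℝ V := by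
  refine ⟨fun u => (powerDist_pos hp α u).le, ?_⟩
  simp only [powerDist]
  rw [← Finset.sum_div, div_self (sum_rpow_pos hp α).ne']

lemma log_powerDist (hp : ∀ u, 0 < p u) (α : ℝ) (u : V) :
    Real.log (powerDist p α u) = α * Real.log (p u) - Real.log (∑ v, p v ^ α) := by
  rw [powerDist, Real.log_div (Real.rpow_pos_of_pos (hp u) α).ne' (sum_rpow_pos hp α).ne',
    Real.log_rpow (hp u)]

omit [Nonempty V] in
lemma powerDist_one (hp : p ∈ stdSimplex ℝ V) : powerDist p 1 = p := by
  ext u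
  simp [powerDist, hp.2]

lemma continuous_powerDist (hp : ∀ u, 0 < p u) : Continuous (powerDist p) := by
  have h : ∀ u, Continuous fun α : ℝ => p u ^ α := fun u =>
    Real.continuous_const_rpow (hp u).ne'
  exact continuous_pi fun u =>
    (h u).div (continuous_finsetSum _ fun v _ => h v) fun α => (sum_rpow_pos hp α).ne'

lemma kl_powerDist (hp : ∀ u, 0 < p u) (α : ℝ) {r : V → ℝ} (hr : r ∈ stdSimplex ℝ V) :
    kl r (powerDist p α) =
      Real.log (∑ v, p v ^ α) + α * kl r p - (1 - α) * entropy r := by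
  rw [kl_eq_neg_entropy_sub (powerDist_pos hp α), kl_eq_neg_entropy_sub hp]
  simp_rw [log_powerDist hp, mul_sub]
  rw [Finset.sum_sub_distrib, ← Finset.sum_mul, hr.2]
  have : ∑ u, r u * (α * Real.log (p u)) = α * ∑ u, r u * Real.log (p u) := by
    rw [Finset.mul_sum]
    exact Finset.sum_congr rfl fun u _ => by ring
  rw [this]
  ring

lemma entropy_lt_entropy_powerDist (hp : ∀ u, 0 < p u) {α : ℝ} (hα : α ∈ Ico (0 : ℝ) 1)
    {r : V → ℝ} (hr : r ∈ stdSimplex ℝ V) (hne : r ≠ powerDist p α)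
    (hkl : α * kl r p ≤ α * kl (powerDist p α) p) :
    entropy r < entropy (powerDist p α) := by
  have h := kl_pos hr (powerDist_mem_stdSimplex hp α) (powerDist_pos hp α) hne
  have h0 := kl_self (powerDist_pos hp α)
  rw [kl_powerDist hp α hr] at h
  rw [kl_powerDist hp α (powerDist_mem_stdSimplex hp α)] at h0
  have h1 : 0 < 1 - α := sub_pos.2 hα.2
  refine lt_of_mul_lt_mul_left ?_ h1.le
  linarith

/-- The calibrated exponent: either the divergence of `powerDist p α` equals `ε`, or no exponent in
the unit interval achieves this and `α = 0`. -/
lemma exists_calibrated_exponent (hp : p ∈ stdSimplex ℝ V) (hp_pos : ∀ u, 0 < p u) {ε : ℝ}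
    (hε : 0 ≤ ε) :
    ∃ α ∈ Icc (0 : ℝ) 1,
      ((∃ β ∈ Icc (0 : ℝ) 1, kl (powerDist p β) p = ε) → kl (powerDist p α) p = ε) ∧
      ((¬ ∃ β ∈ Icc (0 : ℝ) 1, kl (powerDist p β) p = ε) → α = 0) ∧
      (ε = 0 → α = 1) ∧ kl (powerDist p α) p ≤ ε ∧
      ∀ r ∈ stdSimplex ℝ V, kl r p ≤ ε → r ≠ powerDist p α →
        entropy r < entropy (powerDist p α) := by
  have h1 : kl (powerDist p 1) p = 0 := by rw [powerDist_one hp, kl_self hp_pos]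
  rcases hε.eq_or_lt with rfl | hε'
  · refine ⟨1, by simp, fun _ => h1, fun h => (h ⟨1, by simp, h1⟩).elim, fun _ => rfl, h1.le,
      fun r hr hk hne => ?_⟩
    rw [powerDist_one hp] at hne
    exact absurd (kl_pos hr hp hp_pos hne) (not_lt.2 hk)
  · by_cases hex : ∃ β ∈ Icc (0 : ℝ) 1, kl (powerDist p β) p = ε
    · obtain ⟨β, hβ, hkβ⟩ := hex
      have hβ1 : β ≠ 1 := by
        rintro rfl
        exact hε'.ne (h1.symm.trans hkβ)
      refine ⟨β, hβ, fun _ => hkβ, fun h => (h ⟨β, hβ, hkβ⟩).elim, fun h => (hε'.ne' h).elim,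
        hkβ.le, fun r hr hk hne => ?_⟩
      exact entropy_lt_entropy_powerDist hp_pos ⟨hβ.1, hβ.2.lt_of_ne hβ1⟩ hr hne
        (mul_le_mul_of_nonneg_left (hk.trans hkβ.ge) hβ.1)
    · refine ⟨0, by simp, fun h => (hex h).elim, fun _ => rfl, fun h => (hε'.ne' h).elim, ?_,
        fun r hr hk hne => entropy_lt_entropy_powerDist hp_pos ⟨le_rfl, one_pos⟩ hr hne (by simp)⟩
      by_contra! hlt
      have hc : ContinuousOn (fun α => kl (powerDist p α) p) (Icc 0 1) :=
        ((continuous_kl hp_pos).comp (continuous_powerDist hp_pos)).continuousOn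
      obtain ⟨β, hβ, hkβ⟩ := intermediate_value_Icc' zero_le_one hc ⟨h1.trans_le hε, hlt.le⟩
      exact hex ⟨β, hβ, hkβ⟩

end PowerDist

end Divergence

section Gumbel

open Filter Topology

/-- The density of the standard Gumbel law. -/
noncomputable def gumbelDensity (x : ℝ) : ℝ := Real.exp (-(x + Real.exp (-x)))

lemma gumbelDensity_pos (x : ℝ) : 0 < gumbelDensity x := Real.exp_pos _

lemma continuous_gumbelDensity : Continuous gumbelDensity := by
  unfold gumbelDensity
  fun_prop

lemma stdGumbel_eq : stdGumbel = volume.withDensity fun x => ENNReal.ofReal (gumbelDensity x) := rfl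

lemma measurable_ofReal_gumbelDensity : Measurable fun x => ENNReal.ofReal (gumbelDensity x) :=
  continuous_gumbelDensity.measurable.ennreal_ofReal

lemma hasDerivWithinAt_exp_neg (x : ℝ) (s : Set ℝ) :
    HasDerivWithinAt (fun y => Real.exp (-y)) (-Real.exp (-x)) s x := by
  simpa using ((hasDerivAt_neg x).exp).hasDerivWithinAt

lemma injective_exp_neg : Function.Injective fun y : ℝ => Real.exp (-y) :=
  Real.exp_injective.comp neg_injective

lemma image_exp_neg_univ : (fun y : ℝ => Real.exp (-y)) '' univ = Ioi 0 := by
  ext t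
  constructor
  · rintro ⟨y, -, rfl⟩
    exact Real.exp_pos _
  · intro ht
    exact ⟨-Real.log t, mem_univ _, by simp [Real.exp_log ht]⟩

lemma abs_deriv_smul_exp_neg (x y : ℝ) :
    |-Real.exp (-x)| • (y * Real.exp (-Real.exp (-x))) = gumbelDensity x * y := by
  rw [abs_neg, abs_of_pos (Real.exp_pos _), gumbelDensity, neg_add, Real.exp_add, smul_eq_mul]
  ring

/-- The substitution `t = exp (-x)` for integrability against the Gumbel density. -/
lemma integrable_gumbelDensity_mul_iff (f : ℝ → ℝ) :
    Integrable (fun x => gumbelDensity x * f (Real.exp (-x))) ↔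
      IntegrableOn (fun t => f t * Real.exp (-t)) (Ioi 0) := by
  rw [← image_exp_neg_univ, integrableOn_image_iff_integrableOn_abs_deriv_smul MeasurableSet.univ
    (fun x _ => hasDerivWithinAt_exp_neg x univ) injective_exp_neg.injOn]
  simp_rw [abs_deriv_smul_exp_neg, integrableOn_univ]

/-- The substitution `t = exp (-x)` for integrals against the Gumbel density. -/
lemma integral_gumbelDensity_mul (f : ℝ → ℝ) :
    ∫ x, gumbelDensity x * f (Real.exp (-x)) = ∫ t in Ioi 0, f t * Real.exp (-t) := by
  rw [← image_exp_neg_univ, integral_image_eq_integral_abs_deriv_smul MeasurableSet.univ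
    (fun x _ => hasDerivWithinAt_exp_neg x univ) injective_exp_neg.injOn]
  simp_rw [abs_deriv_smul_exp_neg, setIntegral_univ]

lemma integrable_gumbelDensity : Integrable gumbelDensity := by
  have h := integrable_gumbelDensity_mul_iff fun _ => 1
  simp only [mul_one, one_mul] at h
  exact h.2 (integrableOn_exp_neg_Ioi 0)

lemma integrableOn_log_mul_exp_neg :
    IntegrableOn (fun t => Real.log t * Real.exp (-t)) (Ioi 0) := by
  have h := (mellin_hasDerivAt_of_isBigO_rpow (E := ℂ) (f := fun t => (Real.exp (-t) : ℂ))
    (s := 1) (a := 2) (b := 0) ?_ ?_ (by norm_num) ?_ (by norm_num)).1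
  · have h' := h.re
    refine h'.congr (ae_of_all _ fun t => ?_)
    simp only [sub_self, Complex.cpow_zero, one_smul, RCLike.re_eq_complex_re]
    rw [Complex.real_smul, ← Complex.ofReal_mul, Complex.ofReal_re]
  · refine (Continuous.continuousOn ?_).locallyIntegrableOn measurableSet_Ioi
    fun_prop
  · rw [← Asymptotics.isBigO_norm_left]
    simp_rw [Complex.norm_real,
      Asymptotics.isBigO_norm_left]
    simpa only [neg_one_mul] using (isLittleO_exp_neg_mul_rpow_atTop zero_lt_one _).isBigO
  · simp_rw [neg_zero, Real.rpow_zero]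
    refine Asymptotics.isBigO_const_of_tendsto (y := (1 : ℂ)) ?_ one_ne_zero
    have hc : Continuous fun t : ℝ => (Real.exp (-t) : ℂ) := by fun_prop
    simpa using (hc.tendsto 0).mono_left nhdsWithin_le_nhds

lemma integral_log_mul_exp_neg :
    ∫ t in Ioi 0, Real.log t * Real.exp (-t) = -Real.eulerMascheroniConstant := by
  have h1 : HasDerivAt Complex.Gamma
      (∫ t : ℝ in Ioi 0, (t : ℂ) ^ ((1 : ℂ) - 1) * (Real.log t * Real.exp (-t))) 1 := by
    refine (Complex.hasDerivAt_GammaIntegral (s := 1) (by simp)).congr_of_eventuallyEq ?_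
    have : ∀ᶠ s : ℂ in 𝓝 1, 0 < s.re :=
      (Complex.continuous_re.tendsto 1).eventually (lt_mem_nhds (by simp))
    filter_upwards [this] with s hs using Complex.Gamma_eq_integral hs
  have h2 := h1.unique Complex.hasDerivAt_Gamma_one
  simp only [sub_self, Complex.cpow_zero, one_mul] at h2
  simp_rw [← Complex.ofReal_mul] at h2
  rw [integral_complex_ofReal] at h2
  exact_mod_cast h2

lemma integrable_id_stdGumbel : Integrable (fun x : ℝ => x) stdGumbel := by
  have h := (integrable_gumbelDensity_mul_iff Real.log).2 integrableOn_log_mul_exp_neg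
  rw [stdGumbel_eq, integrable_withDensity_iff_integrable_smul' measurable_ofReal_gumbelDensity
    (ae_of_all _ fun _ => ENNReal.ofReal_lt_top)]
  refine h.neg.congr (ae_of_all _ fun x => ?_)
  simp [ENNReal.toReal_ofReal (gumbelDensity_pos x).le]

lemma integral_id_stdGumbel : ∫ x, x ∂stdGumbel = Real.eulerMascheroniConstant := by
  have h := integral_gumbelDensity_mul Real.log
  rw [integral_log_mul_exp_neg] at h
  rw [stdGumbel_eq, integral_withDensity_eq_integral_toReal_smul measurable_ofReal_gumbelDensity
    (ae_of_all _ fun _ => ENNReal.ofReal_lt_top)]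
  simp_rw [Real.log_exp, mul_neg, integral_neg, neg_inj] at h
  simpa [ENNReal.toReal_ofReal (gumbelDensity_pos _).le] using h

lemma stdGumbel_Iic (x : ℝ) :
    stdGumbel (Iic x) = ENNReal.ofReal (Real.exp (-Real.exp (-x))) := by
  rw [stdGumbel_eq, withDensity_apply _ measurableSet_Iic,
    ← ofReal_integral_eq_lintegral_ofReal integrable_gumbelDensity.integrableOn
      (ae_of_all _ fun x => (gumbelDensity_pos x).le),
    integral_Iic_of_hasDerivAt_of_tendsto' (f := fun y => Real.exp (-Real.exp (-y))) (m := 0) ?_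
      integrable_gumbelDensity.integrableOn ?_, sub_zero]
  · intro y _
    have h := ((hasDerivAt_neg y).exp.neg).exp
    refine h.congr_deriv ?_
    simp only [gumbelDensity, neg_add, Real.exp_add, Pi.neg_apply]
    ring
  · exact Real.tendsto_exp_atBot.comp (tendsto_neg_atTop_atBot.comp
      (Real.tendsto_exp_atTop.comp tendsto_neg_atBot_atTop))

end Gumbel

section ExpectedMaximum

variable {V Ω : Type*} [Fintype V]

/-- The largest shifted score `g v + τ v` over `v ∈ S`. -/
noncomputable def shiftedMax (S : Finset V) (hS : S.Nonempty) (τ g : V → ℝ) : ℝ :=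
  S.sup' hS fun v => g v + τ v

variable {S : Finset V} {hS : S.Nonempty} {τ g : V → ℝ}

omit [Fintype V] in
lemma le_shiftedMax {v : V} (hv : v ∈ S) : g v + τ v ≤ shiftedMax S hS τ g :=
  Finset.le_sup' (fun v => g v + τ v) hv

omit [Fintype V] in
lemma shiftedMax_le_iff {a : ℝ} : shiftedMax S hS τ g ≤ a ↔ ∀ v ∈ S, g v + τ v ≤ a :=
  Finset.sup'_le_iff hS _

omit [Fintype V] in
lemma exists_eq_shiftedMax (hS : S.Nonempty) (τ g : V → ℝ) :
    ∃ v ∈ S, g v + τ v = shiftedMax S hS τ g := by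
  obtain ⟨v, hv, h⟩ := S.exists_mem_eq_sup' hS fun v => g v + τ v
  exact ⟨v, hv, h.symm⟩

omit [Fintype V] in
lemma measurable_shiftedMax (hS : S.Nonempty) (τ : V → ℝ) : Measurable (shiftedMax S hS τ) := by
  have h := Finset.measurable_sup' hS (f := fun v (g : V → ℝ) => g v + τ v) fun v _ =>
    (measurable_pi_apply v).add_const _
  convert h using 1
  ext g
  rw [shiftedMax, Finset.sup'_apply]

lemma abs_shiftedMax_le (hS : S.Nonempty) (τ g : V → ℝ) :
    |shiftedMax S hS τ g| ≤ ∑ v, |g v + τ v| := by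
  obtain ⟨v, -, hv⟩ := exists_eq_shiftedMax hS τ g
  rw [← hv]
  exact Finset.single_le_sum (f := fun v => |g v + τ v|) (fun _ _ => abs_nonneg _)
    (Finset.mem_univ v)

lemma mul_sum_le_shiftedMax {x : V → ℝ} (hx : x ∈ stdSimplex ℝ V) (hxS : ∀ u ∉ S, x u = 0) :
    ∑ u, (g u + τ u) * x u ≤ shiftedMax S hS τ g := by
  calc ∑ u, (g u + τ u) * x u ≤ ∑ u, shiftedMax S hS τ g * x u := by
        refine Finset.sum_le_sum fun u _ => ?_
        by_cases hu : u ∈ S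
        · exact mul_le_mul_of_nonneg_right (le_shiftedMax hu) (hx.1 u)
        · simp [hxS u hu]
    _ = shiftedMax S hS τ g := by rw [← Finset.mul_sum, hx.2, mul_one]

lemma mul_sum_eq_shiftedMax {x : V → ℝ} (hx : x ∈ stdSimplex ℝ V)
    (h : ∀ u, x u ≠ 0 → g u + τ u = shiftedMax S hS τ g) :
    ∑ u, (g u + τ u) * x u = shiftedMax S hS τ g := by
  calc ∑ u, (g u + τ u) * x u = ∑ u, shiftedMax S hS τ g * x u := by
        refine Finset.sum_congr rfl fun u _ => ?_
        rcases eq_or_ne (x u) 0 with hu | hu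
        · simp [hu]
        · rw [h u hu]
    _ = shiftedMax S hS τ g := by rw [← Finset.mul_sum, hx.2, mul_one]

variable [MeasurableSpace Ω] {P : Measure Ω} [IsProbabilityMeasure P] {G : Ω → V → ℝ}
  {q : (V → ℝ) → V → ℝ}

omit [IsProbabilityMeasure P] in
lemma aemeasurable_of_integrable (hG : ∀ u, Integrable (fun ω => G ω u) P) : AEMeasurable G P :=
  aemeasurable_pi_iff.2 fun u => (hG u).aemeasurable

/-- The expected largest shifted score. -/
noncomputable def expMax (P : Measure Ω) (G : Ω → V → ℝ) (S : Finset V) (hS : S.Nonempty)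
    (τ : V → ℝ) : ℝ := ∫ ω, shiftedMax S hS τ (G ω) ∂P

lemma integrable_shiftedMax (hG : ∀ u, Integrable (fun ω => G ω u) P) (hS : S.Nonempty)
    (τ : V → ℝ) : Integrable (fun ω => shiftedMax S hS τ (G ω)) P := by
  refine Integrable.mono' (g := fun ω => ∑ v, |G ω v + τ v|)
    (integrable_finsetSum _ fun v _ => ((hG v).add (integrable_const _)).abs)
    ((measurable_shiftedMax hS τ).comp_aemeasurable
      (aemeasurable_of_integrable hG)).aestronglyMeasurable
    (ae_of_all _ fun ω => abs_shiftedMax_le hS τ (G ω))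

lemma IsMechanism.integrable (hG : AEMeasurable G P) (hq : IsMechanism P G q) (u : V) :
    Integrable (fun ω => q (G ω) u) P := by
  refine Integrable.of_bound (C := 1)
    ((measurable_pi_iff.1 hq.1 u).comp_aemeasurable hG).aestronglyMeasurable ?_
  filter_upwards [hq.2] with ω hω
  rw [Real.norm_of_nonneg (hω.1 u), ← hω.2]
  exact Finset.single_le_sum (fun v _ => hω.1 v) (Finset.mem_univ u)

lemma IsMechanism.integrable_mul (hG : ∀ u, Integrable (fun ω => G ω u) P)
    (hq : IsMechanism P G q) (u : V) : Integrable (fun ω => G ω u * q (G ω) u) P := by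
  have hm := hq.integrable (aemeasurable_of_integrable hG) u
  refine (hG u).mul_bdd (c := 1) hm.aestronglyMeasurable ?_
  filter_upwards [hq.2] with ω hω
  rw [Real.norm_of_nonneg (hω.1 u), ← hω.2]
  exact Finset.single_le_sum (fun v _ => hω.1 v) (Finset.mem_univ u)

lemma IsMechanism.mean_mem_stdSimplex (hG : AEMeasurable G P) (hq : IsMechanism P G q) :
    mean P G q ∈ stdSimplex ℝ V := by
  refine ⟨fun u => integral_nonneg_of_ae ?_, ?_⟩
  · filter_upwards [hq.2] with ω hω using hω.1 u
  · simp only [mean]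
    rw [← integral_finsetSum _ fun u _ => hq.integrable hG u]
    rw [integral_congr_ae (g := fun _ => 1) (hq.2.mono fun ω hω => hω.2)]
    simp

lemma IsMechanism.score_add (hG : ∀ u, Integrable (fun ω => G ω u) P)
    (hq : IsMechanism P G q) (τ : V → ℝ) :
    score P G q + ∑ u, mean P G q u * τ u = ∫ ω, ∑ u, (G ω u + τ u) * q (G ω) u ∂P := by
  have h1 := fun u => hq.integrable (aemeasurable_of_integrable hG) u
  have h2 := fun u => hq.integrable_mul hG u
  simp only [score, mean, ← integral_mul_const]
  rw [← integral_finsetSum _ fun u _ => (h1 u).mul_const _, ← integral_add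
    (integrable_finsetSum _ fun u _ => h2 u) (integrable_finsetSum _ fun u _ => (h1 u).mul_const _)]
  refine integral_congr_ae (ae_of_all _ fun ω => ?_)
  simp only [← Finset.sum_add_distrib]
  exact Finset.sum_congr rfl fun u _ => by ring

lemma IsMechanism.integrable_sum (hG : ∀ u, Integrable (fun ω => G ω u) P)
    (hq : IsMechanism P G q) (τ : V → ℝ) :
    Integrable (fun ω => ∑ u, (G ω u + τ u) * q (G ω) u) P := by
  refine integrable_finsetSum _ fun u _ => ?_
  simp_rw [add_mul]
  exact (hq.integrable_mul hG u).add
    ((hq.integrable (aemeasurable_of_integrable hG) u).const_mul _)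

lemma IsMechanism.score_add_le (hG : ∀ u, Integrable (fun ω => G ω u) P)
    (hq : IsMechanism P G q) (hS : S.Nonempty) (hqS : ∀ u ∉ S, mean P G q u = 0) (τ : V → ℝ) :
    score P G q + ∑ u, mean P G q u * τ u ≤ expMax P G S hS τ := by
  rw [hq.score_add hG τ]
  have h0 : ∀ u, u ∉ S → ∀ᵐ ω ∂P, q (G ω) u = 0 := fun u hu =>
    (integral_eq_zero_iff_of_nonneg_ae (hq.2.mono fun ω hω => hω.1 u)
      (hq.integrable (aemeasurable_of_integrable hG) u)).1 (hqS u hu)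
  have h0' : ∀ᵐ ω ∂P, ∀ u, u ∉ S → q (G ω) u = 0 :=
    ae_all_iff.2 fun u => Filter.eventually_imp_distrib_left.2 (h0 u)
  refine integral_mono_ae (hq.integrable_sum hG τ) (integrable_shiftedMax hG hS τ) ?_
  filter_upwards [hq.2, h0'] with ω h1 h2 using mul_sum_le_shiftedMax h1 h2

lemma IsMechanism.score_add_eq (hG : ∀ u, Integrable (fun ω => G ω u) P)
    (hq : IsMechanism P G q) (hS : S.Nonempty) (τ : V → ℝ)
    (h : ∀ᵐ ω ∂P, ∀ u, q (G ω) u ≠ 0 → G ω u + τ u = shiftedMax S hS τ (G ω)) :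
    score P G q + ∑ u, mean P G q u * τ u = expMax P G S hS τ := by
  rw [hq.score_add hG τ]
  refine integral_congr_ae ?_
  filter_upwards [hq.2, h] with ω h1 h2 using mul_sum_eq_shiftedMax h1 h2

end ExpectedMaximum

section TieBreak

variable {V Ω : Type*} [Fintype V] {τ g : V → ℝ} {T : (V → ℝ) → V → ℝ}

lemma mem_maximizers {u : V} : u ∈ maximizers g τ ↔ ∀ v, g v + τ v ≤ g u + τ u := by
  simp [maximizers]

lemma mem_maximizers_iff_eq_shiftedMax (h : (Finset.univ : Finset V).Nonempty) {u : V} :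
    u ∈ maximizers g τ ↔ g u + τ u = shiftedMax Finset.univ h τ g := by
  rw [mem_maximizers]
  constructor
  · exact fun hu => le_antisymm (le_shiftedMax (Finset.mem_univ u))
      (shiftedMax_le_iff.2 fun v _ => hu v)
  · exact fun hu v => (le_shiftedMax (Finset.mem_univ v)).trans_eq hu.symm

lemma maximizers_nonempty [Nonempty V] (g τ : V → ℝ) : (maximizers g τ).Nonempty := by
  obtain ⟨u, -, hu⟩ := exists_eq_shiftedMax Finset.univ_nonempty τ g
  exact ⟨u, (mem_maximizers_iff_eq_shiftedMax _).2 hu⟩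

lemma measurableSet_mem_maximizers (τ : V → ℝ) (u : V) :
    MeasurableSet {g : V → ℝ | u ∈ maximizers g τ} := by
  simp only [mem_maximizers, ofPred_forall]
  exact MeasurableSet.iInter fun v =>
    measurableSet_le ((measurable_pi_apply v).add_const _) ((measurable_pi_apply u).add_const _)

lemma measurable_comp_maximizers (τ : V → ℝ) (f : Finset V → ℝ) :
    Measurable fun g : V → ℝ => f (maximizers g τ) := by
  let : MeasurableSpace (Finset V) := ⊤
  have h : Measurable fun g : V → ℝ => maximizers g τ := by
    refine measurable_to_countable' fun N => ?_
    have : (fun g : V → ℝ => maximizers g τ) ⁻¹' {N}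
        = ⋂ u, {g : V → ℝ | u ∈ maximizers g τ ↔ u ∈ N} := by
      ext g
      simp [Finset.ext_iff]
    rw [this]
    exact MeasurableSet.iInter fun u =>
      (measurableSet_mem_maximizers τ u).iff (MeasurableSet.const _)
  exact measurable_from_top.comp h

open Classical in
lemma IsTieBreak.argmaxMechanism_apply (hT : IsTieBreak τ T) (g : V → ℝ) (u : V) :
    argmaxMechanism τ T g u = if u ∈ maximizers g τ then T g u else 0 := by
  unfold argmaxMechanism
  split_ifs with h1 h2 h3 h4 h5
  · have := hT.2.2 g
    rw [h1, Finset.sum_singleton] at this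
    exact this.symm
  · simp [h1] at h2
  · rfl
  · exact (h4 h3.1).elim
  · have h6 : (maximizers g τ).card = 1 :=
      le_antisymm (not_lt.1 fun h => h3 ⟨h5, h⟩) (Finset.card_pos.2 ⟨u, h5⟩)
    obtain ⟨v, hv⟩ := Finset.card_eq_one.1 h6
    rw [hv, Finset.mem_singleton] at h5
    exact (h1 (h5 ▸ hv)).elim
  · rfl

lemma IsTieBreak.argmaxMechanism_mem_stdSimplex (hT : IsTieBreak τ T) (g : V → ℝ) :
    argmaxMechanism τ T g ∈ stdSimplex ℝ V := by
  classical
  refine ⟨fun u => ?_, ?_⟩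
  · rw [hT.argmaxMechanism_apply]
    split_ifs
    exacts [(hT.2.1 g u).1, le_rfl]
  · simp_rw [hT.argmaxMechanism_apply]
    rw [← hT.2.2 g, Finset.sum_ite_mem, Finset.univ_inter]

lemma IsTieBreak.mem_maximizers_of_ne_zero (hT : IsTieBreak τ T) {u : V}
    (h : argmaxMechanism τ T g u ≠ 0) : u ∈ maximizers g τ := by
  classical
  rw [hT.argmaxMechanism_apply] at h
  by_contra h'
  exact h (if_neg h')

lemma IsTieBreak.measurable_argmaxMechanism (hT : IsTieBreak τ T) :
    Measurable (argmaxMechanism τ T) := by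
  classical
  refine measurable_pi_iff.2 fun u => ?_
  simp_rw [hT.argmaxMechanism_apply]
  exact Measurable.ite (measurableSet_mem_maximizers τ u) (measurable_pi_iff.1 hT.1 u)
    measurable_const

lemma isTieBreak_uniformTieBreak [Nonempty V] (τ : V → ℝ) :
    IsTieBreak τ (uniformTieBreak τ) := by
  refine ⟨measurable_pi_iff.2 fun _ => measurable_comp_maximizers τ fun N => (N.card : ℝ)⁻¹,
    fun g u => ⟨by simp [uniformTieBreak], ?_⟩, fun g => ?_⟩
  · have h : (1 : ℝ) ≤ (maximizers g τ).card :=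
      mod_cast Finset.card_pos.2 (maximizers_nonempty g τ)
    exact inv_le_one_of_one_le₀ h
  · have h : ((maximizers g τ).card : ℝ) ≠ 0 :=
      mod_cast (Finset.card_pos.2 (maximizers_nonempty g τ)).ne'
    simp [uniformTieBreak, h]

lemma IsTieBreak.convexCombination {T' : (V → ℝ) → V → ℝ} (hT : IsTieBreak τ T)
    (hT' : IsTieBreak τ T') {s : ℝ} (hs : s ∈ Icc (0 : ℝ) 1) :
    IsTieBreak τ (fun g u => (1 - s) * T g u + s * T' g u) := by
  refine ⟨measurable_pi_iff.2 fun u => ((measurable_pi_iff.1 hT.1 u).const_mul _).add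
    ((measurable_pi_iff.1 hT'.1 u).const_mul _), fun g u => ?_, fun g => ?_⟩
  · exact (convex_Icc (0 : ℝ) 1) (hT.2.1 g u) (hT'.2.1 g u) (sub_nonneg.2 hs.2) hs.1 (by ring)
  · rw [Finset.sum_add_distrib, ← Finset.mul_sum, ← Finset.mul_sum, hT.2.2, hT'.2.2]
    ring

variable [MeasurableSpace Ω] {P : Measure Ω} [IsProbabilityMeasure P] {G : Ω → V → ℝ}

omit [IsProbabilityMeasure P] in
lemma IsTieBreak.isMechanism (hT : IsTieBreak τ T) : IsMechanism P G (argmaxMechanism τ T) :=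
  ⟨hT.measurable_argmaxMechanism, ae_of_all _ fun _ => hT.argmaxMechanism_mem_stdSimplex _⟩

lemma IsTieBreak.score_add_eq (hG : ∀ u, Integrable (fun ω => G ω u) P)
    (hT : IsTieBreak τ T) (h : (Finset.univ : Finset V).Nonempty) :
    score P G (argmaxMechanism τ T) + mean P G (argmaxMechanism τ T) ⬝ᵥ τ =
      expMax P G Finset.univ h τ :=
  hT.isMechanism.score_add_eq hG h τ
    (ae_of_all _ fun _ _ hu =>
      (mem_maximizers_iff_eq_shiftedMax h).1 (hT.mem_maximizers_of_ne_zero hu))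

lemma IsMechanism.score_add_dotProduct_le (hG : ∀ u, Integrable (fun ω => G ω u) P)
    {q : (V → ℝ) → V → ℝ} (hq : IsMechanism P G q) (h : (Finset.univ : Finset V).Nonempty)
    (τ : V → ℝ) :
    score P G q + mean P G q ⬝ᵥ τ ≤ expMax P G Finset.univ h τ :=
  hq.score_add_le hG h (fun u hu => (hu (Finset.mem_univ u)).elim) τ

/-- A saddle point condition that makes an argmax mechanism optimal. -/
lemma IsTieBreak.isOptimal [Nonempty V] (hG : ∀ u, Integrable (fun ω => G ω u) P)
    {p : V → ℝ} {ε : ℝ} (hT : IsTieBreak τ T)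
    (hkl : kl (mean P G (argmaxMechanism τ T)) p ≤ ε)
    (hmin : ∀ r ∈ klBall p ε, mean P G (argmaxMechanism τ T) ⬝ᵥ τ ≤ r ⬝ᵥ τ) :
    IsOptimal P G p ε (argmaxMechanism τ T) := by
  refine ⟨⟨hT.isMechanism, hkl⟩, fun q hq => ?_⟩
  have h1 := hq.1.score_add_dotProduct_le hG Finset.univ_nonempty τ
  rw [← hT.score_add_eq hG] at h1
  have h2 := hmin _ ⟨hq.1.mean_mem_stdSimplex (aemeasurable_of_integrable hG), hq.2⟩
  linarith

end TieBreak

section Subdifferential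

variable {V Ω : Type*} [Fintype V]

/-- Weights on the sets `N` of tied candidates, supported on `N`. -/
def tieWeights (V : Type*) [Fintype V] : Set (Finset V → V → ℝ) :=
  Set.pi univ fun N => stdSimplex ℝ V ∩ {x | N.Nonempty → ∀ u, u ∉ N → x u = 0}

lemma convex_tieWeights : Convex ℝ (tieWeights V) := by
  refine convex_pi fun N _ => (convex_stdSimplex ℝ V).inter ?_
  intro x hx y hy a b _ _ _ hN u hu
  simp [hx hN u hu, hy hN u hu]

lemma isCompact_tieWeights : IsCompact (tieWeights V) := by
  refine isCompact_univ_pi fun N => (isCompact_stdSimplex ℝ V).inter_right ?_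
  simp only [ofPred_forall]
  exact isClosed_iInter fun _ => isClosed_iInter fun u => isClosed_iInter fun _ =>
    isClosed_eq (continuous_apply u) continuous_const

variable [Nonempty V] {t : Finset V → V → ℝ} {τ : V → ℝ}

lemma isTieBreak_of_mem_tieWeights (ht : t ∈ tieWeights V) (τ : V → ℝ) :
    IsTieBreak τ (fun g => t (maximizers g τ)) := by
  refine ⟨measurable_pi_iff.2 fun u => measurable_comp_maximizers τ fun N => t N u,
    fun g u => ?_, fun g => ?_⟩
  · have h := (ht (maximizers g τ) trivial).1
    refine ⟨h.1 u, ?_⟩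
    rw [← h.2]
    exact Finset.single_le_sum (fun v _ => h.1 v) (Finset.mem_univ u)
  · have h := ht (maximizers g τ) trivial
    rw [← h.1.2]
    exact Finset.sum_subset (Finset.subset_univ _) fun u _ hu =>
      h.2 (maximizers_nonempty g τ) u hu

lemma argmaxMechanism_of_mem_tieWeights (ht : t ∈ tieWeights V) (τ : V → ℝ) :
    argmaxMechanism τ (fun g => t (maximizers g τ)) = fun g => t (maximizers g τ) := by
  classical
  ext g u
  rw [(isTieBreak_of_mem_tieWeights ht τ).argmaxMechanism_apply]
  split_ifs with h
  · rfl
  · exact ((ht (maximizers g τ) trivial).2 (maximizers_nonempty g τ) u h).symm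

variable [MeasurableSpace Ω] {P : Measure Ω} [IsProbabilityMeasure P] {G : Ω → V → ℝ}

omit [Nonempty V] in
lemma integrable_comp_maximizers (hG : AEMeasurable G P) (τ : V → ℝ) (f : Finset V → ℝ) :
    Integrable (fun ω => f (maximizers (G ω) τ)) P := by
  refine Integrable.of_bound (C := ∑ N, |f N|)
    ((measurable_comp_maximizers τ f).comp_aemeasurable hG).aestronglyMeasurable
    (ae_of_all _ fun ω => ?_)
  exact Finset.single_le_sum (f := fun N => |f N|) (fun _ _ => abs_nonneg _) (Finset.mem_univ _)

/-- The averaged distribution as a linear function of the weights. -/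
noncomputable def tieMean (hG : AEMeasurable G P) (τ : V → ℝ) :
    (Finset V → V → ℝ) →ₗ[ℝ] V → ℝ where
  toFun t := mean P G fun g => t (maximizers g τ)
  map_add' t t' := by
    ext u
    exact integral_add (integrable_comp_maximizers hG τ fun N => t N u)
      (integrable_comp_maximizers hG τ fun N => t' N u)
  map_smul' c t := by
    ext u
    exact integral_const_mul c _

omit [Nonempty V] in
lemma shiftedMax_le_add_norm (S : Finset V) (hS : S.Nonempty) (τ τ' g : V → ℝ) :
    shiftedMax S hS τ' g ≤ shiftedMax S hS τ g + ‖τ' - τ‖ := by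
  refine shiftedMax_le_iff.2 fun v hv => ?_
  have h1 := le_shiftedMax (hS := hS) (τ := τ) (g := g) hv
  have h2 := (le_abs_self _).trans (norm_le_pi_norm (τ' - τ) v)
  rw [Pi.sub_apply] at h2
  linarith

omit [Nonempty V] in
lemma expMax_le_add_norm (hG : ∀ u, Integrable (fun ω => G ω u) P) (S : Finset V)
    (hS : S.Nonempty) (τ τ' : V → ℝ) :
    expMax P G S hS τ' ≤ expMax P G S hS τ + ‖τ' - τ‖ := by
  have h : ∫ ω, (shiftedMax S hS τ (G ω) + ‖τ' - τ‖) ∂P = expMax P G S hS τ + ‖τ' - τ‖ := by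
    rw [integral_add (integrable_shiftedMax hG hS τ) (integrable_const _)]
    simp [expMax]
  rw [← h]
  exact integral_mono (integrable_shiftedMax hG hS τ')
    ((integrable_shiftedMax hG hS τ).add (integrable_const _))
    fun ω => shiftedMax_le_add_norm S hS τ τ' (G ω)

omit [Nonempty V] in
lemma eventually_shiftedMax_add_smul (h : (Finset.univ : Finset V).Nonempty) (g τ d : V → ℝ)
    {c : V} (hc : c ∈ maximizers g τ) (hcd : ∀ v ∈ maximizers g τ, d v ≤ d c) :
    ∀ᶠ s : ℝ in nhdsWithin 0 (Ioi 0), shiftedMax Finset.univ h (τ + s • d) g =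
      shiftedMax Finset.univ h τ g + s * d c := by
  have hc' := (mem_maximizers_iff_eq_shiftedMax h).1 hc
  have hlt : ∀ v, v ∉ maximizers g τ →
      ∀ᶠ s : ℝ in nhdsWithin 0 (Ioi 0), g v + (τ v + s * d v) ≤ g c + τ c + s * d c := by
    intro v hv
    have hv' : g v + τ v < g c + τ c :=
      (hc'.ge.trans' (le_shiftedMax (Finset.mem_univ v))).lt_of_ne fun h' =>
        hv ((mem_maximizers_iff_eq_shiftedMax h).2 (h'.trans hc'))
    have h1 : Filter.Tendsto (fun s : ℝ => g v + (τ v + s * d v)) (nhds 0)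
        (nhds (g v + τ v)) := by
      have : Continuous fun s : ℝ => g v + (τ v + s * d v) := by fun_prop
      simpa using this.tendsto 0
    have h2 : Filter.Tendsto (fun s : ℝ => g c + τ c + s * d c) (nhds 0)
        (nhds (g c + τ c)) := by
      have : Continuous fun s : ℝ => g c + τ c + s * d c := by fun_prop
      simpa using this.tendsto 0
    exact ((h1.eventually_lt h2 hv').mono fun s hs => hs.le).filter_mono nhdsWithin_le_nhds
  have hall := Filter.eventually_all.2 fun v =>
    Filter.eventually_imp_distrib_left.2 (hlt v)
  filter_upwards [hall, self_mem_nhdsWithin] with s hs hs0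
  rw [← hc']
  apply le_antisymm
  · refine shiftedMax_le_iff.2 fun v _ => ?_
    by_cases hv : v ∈ maximizers g τ
    · have h1 := mem_maximizers.1 hc v
      have h2 := mul_le_mul_of_nonneg_left (hcd v hv) (le_of_lt hs0)
      simp only [Pi.add_apply, Pi.smul_apply, smul_eq_mul]
      linarith
    · exact hs v hv
  · have := le_shiftedMax (hS := h) (τ := τ + s • d) (g := g) (Finset.mem_univ c)
    simp only [Pi.add_apply, Pi.smul_apply, smul_eq_mul] at this
    linarith

/-- The directional derivative of the expected maximum. -/
lemma tendsto_slope_expMax (hG : ∀ u, Integrable (fun ω => G ω u) P)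
    (h : (Finset.univ : Finset V).Nonempty) (τ d : V → ℝ) {c : Finset V → V}
    (hc : ∀ N : Finset V, N.Nonempty → c N ∈ N ∧ ∀ v ∈ N, d v ≤ d (c N))
    {s : ℕ → ℝ} (hs : Filter.Tendsto s Filter.atTop (nhdsWithin 0 (Ioi 0)))
    (hs_pos : ∀ n, 0 < s n) :
    Filter.Tendsto
      (fun n => (expMax P G Finset.univ h (τ + s n • d) - expMax P G Finset.univ h τ) / s n)
      Filter.atTop (nhds (∫ ω, d (c (maximizers (G ω) τ)) ∂P)) := by
  have hi := integrable_shiftedMax hG h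
  have heq : ∀ n, (expMax P G Finset.univ h (τ + s n • d) - expMax P G Finset.univ h τ) / s n =
      ∫ ω, (shiftedMax Finset.univ h (τ + s n • d) (G ω) - shiftedMax Finset.univ h τ (G ω)) / s n
        ∂P := fun n => by
    rw [integral_div, integral_sub (hi _) (hi _), expMax, expMax]
  simp_rw [heq]
  refine tendsto_integral_of_dominated_convergence (fun _ => ‖d‖)
    (fun n => (((hi _).sub (hi _)).div_const _).aestronglyMeasurable) (integrable_const _)
    (fun n => ae_of_all _ fun ω => ?_) (ae_of_all _ fun ω => ?_)
  · have h1 := shiftedMax_le_add_norm Finset.univ h τ (τ + s n • d) (G ω)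
    have h2 := shiftedMax_le_add_norm Finset.univ h (τ + s n • d) τ (G ω)
    rw [norm_sub_rev] at h2
    rw [add_sub_cancel_left, norm_smul, Real.norm_of_nonneg (hs_pos n).le] at h1 h2
    rw [Real.norm_eq_abs, abs_div, abs_of_pos (hs_pos n), div_le_iff₀ (hs_pos n), abs_le]
    constructor <;> linarith
  · have hN := hc _ (maximizers_nonempty (G ω) τ)
    have h1 := hs.eventually (eventually_shiftedMax_add_smul h (G ω) τ d hN.1 hN.2)
    refine tendsto_const_nhds.congr' ?_
    filter_upwards [h1] with n hn
    rw [hn, add_sub_cancel_left, mul_div_cancel_left₀ _ (hs_pos n).ne']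

end Subdifferential

section Duality

variable {V Ω : Type*} [Fintype V]

lemma dotProduct_le_norm {r : V → ℝ} (hr : r ∈ stdSimplex ℝ V) (x : V → ℝ) : r ⬝ᵥ x ≤ ‖x‖ := by
  calc r ⬝ᵥ x ≤ ∑ u, r u * ‖x‖ := Finset.sum_le_sum fun u _ =>
        mul_le_mul_of_nonneg_left ((le_abs_self _).trans (norm_le_pi_norm x u)) (hr.1 u)
    _ = ‖x‖ := by rw [← Finset.sum_mul, hr.2, one_mul]

variable [Nonempty V] [MeasurableSpace Ω] {P : Measure Ω} [IsProbabilityMeasure P] {G : Ω → V → ℝ}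
  {K : Set (V → ℝ)} {p : V → ℝ}

omit [Nonempty V] in
lemma exists_isMinOn_dotProduct (hK : IsCompact K) (hp : p ∈ K) (τ : V → ℝ) :
    ∃ r ∈ K, ∀ r' ∈ K, r ⬝ᵥ τ ≤ r' ⬝ᵥ τ :=
  hK.exists_isMinOn ⟨p, hp⟩ (Continuous.dotProduct continuous_id continuous_const).continuousOn

/-- The dual objective `τ ↦ 𝔼 max (G + τ) - min_{r ∈ K} r ⬝ᵥ τ` attains its minimum. -/
lemma exists_dual_minimizer (hG : ∀ u, Integrable (fun ω => G ω u) P)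
    (hKs : K ⊆ stdSimplex ℝ V) (hp : p ∈ K) (hp_pos : ∀ u, 0 < p u)
    {ρ : (V → ℝ) → V → ℝ} (hρ : ∀ τ, ρ τ ∈ K ∧ ∀ r ∈ K, ρ τ ⬝ᵥ τ ≤ r ⬝ᵥ τ) :
    ∃ τ, ∀ τ', expMax P G Finset.univ Finset.univ_nonempty τ - ρ τ ⬝ᵥ τ ≤
      expMax P G Finset.univ Finset.univ_nonempty τ' - ρ τ' ⬝ᵥ τ' := by
  set D : (V → ℝ) → ℝ := fun τ =>
    expMax P G Finset.univ Finset.univ_nonempty τ - ρ τ ⬝ᵥ τ with hD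
  have hcont : Continuous D := by
    refine (LipschitzWith.of_le_add_mul (f := D) 2 fun x y => ?_).continuous
    have h1 := expMax_le_add_norm hG Finset.univ Finset.univ_nonempty y x
    have h2 := (hρ y).2 _ (hρ x).1
    have h3 := dotProduct_le_norm (hKs (hρ x).1) (y - x)
    rw [dotProduct_sub, norm_sub_rev] at h3
    rw [dist_eq_norm]
    simp only [hD, NNReal.coe_ofNat]
    linarith
  obtain ⟨w, hw⟩ := Finite.exists_min p
  set B : ℝ := ∑ v, |∫ ω, G ω v ∂P| with hB
  set R : ℝ := max 0 ((B + D 0) / p w) with hR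
  have hC : IsCompact (Icc (fun _ => -R) (fun _ => 0) : Set (V → ℝ)) := isCompact_Icc
  have h0 : (0 : V → ℝ) ∈ (Icc (fun _ => -R) (fun _ => 0) : Set (V → ℝ)) :=
    ⟨fun _ => neg_nonpos.2 (le_max_left _ _), fun _ => le_rfl⟩
  obtain ⟨τ, -, hτ⟩ := hC.exists_isMinOn ⟨0, h0⟩ hcont.continuousOn
  refine ⟨τ, fun τ' => ?_⟩
  change D τ ≤ D τ'
  obtain ⟨v, hv⟩ := Finite.exists_max τ'
  set σ : V → ℝ := τ' + fun _ => -τ' v with hσ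
  have hshift : D σ ≤ D τ' := by
    have h1 : expMax P G Finset.univ Finset.univ_nonempty σ ≤
        expMax P G Finset.univ Finset.univ_nonempty τ' + -τ' v := by
      have h : ∫ ω, (shiftedMax Finset.univ Finset.univ_nonempty τ' (G ω) + -τ' v) ∂P =
          expMax P G Finset.univ Finset.univ_nonempty τ' + -τ' v := by
        rw [integral_add (integrable_shiftedMax hG _ τ') (integrable_const _)]
        simp [expMax]
      rw [← h]
      refine integral_mono (integrable_shiftedMax hG _ σ)
        ((integrable_shiftedMax hG _ τ').add (integrable_const _)) fun ω =>
          shiftedMax_le_iff.2 fun u hu => ?_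
      have := le_shiftedMax (hS := Finset.univ_nonempty) (τ := τ') (g := G ω) hu
      simp only [hσ, Pi.add_apply]
      linarith
    have h2 : ρ σ ⬝ᵥ σ = ρ σ ⬝ᵥ τ' + -τ' v := by
      rw [hσ, dotProduct_add, ← hσ]
      congr 1
      rw [dotProduct, ← Finset.sum_mul, (hKs (hρ σ).1).2, one_mul]
    have h3 := (hρ τ').2 _ (hρ σ).1
    simp only [hD]
    linarith
  refine le_trans ?_ hshift
  have hσ_nonpos : ∀ u, σ u ≤ 0 := fun u => by
    have := hv u
    simp only [hσ, Pi.add_apply]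
    linarith
  by_cases hbox : ∀ u, -R ≤ σ u
  · exact hτ (show σ ∈ Icc (fun _ => -R) (fun _ => 0) from ⟨hbox, hσ_nonpos⟩)
  · push Not at hbox
    obtain ⟨u, hu⟩ := hbox
    refine (hτ h0).trans ?_
    have h1 : -B ≤ expMax P G Finset.univ Finset.univ_nonempty σ := by
      have h2 : ∫ ω, G ω v ∂P ≤ expMax P G Finset.univ Finset.univ_nonempty σ := by
        refine integral_mono (hG v) (integrable_shiftedMax hG _ σ) fun ω => ?_
        have := le_shiftedMax (hS := Finset.univ_nonempty) (τ := σ) (g := G ω)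
          (Finset.mem_univ v)
        simpa [hσ] using this
      have h3 : |∫ ω, G ω v ∂P| ≤ B := Finset.single_le_sum
        (f := fun v => |∫ ω, G ω v ∂P|) (fun _ _ => abs_nonneg _) (Finset.mem_univ v)
      linarith [neg_abs_le (∫ ω, G ω v ∂P)]
    have h2 : p ⬝ᵥ σ ≤ p u * σ u := by
      have := Finset.single_le_sum (f := fun u => -(p u * σ u)) (fun u _ =>
        neg_nonneg.2 (mul_nonpos_of_nonneg_of_nonpos (hp_pos u).le (hσ_nonpos u)))
        (Finset.mem_univ u)
      rw [Finset.sum_neg_distrib] at this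
      exact neg_le_neg_iff.1 this
    have h3 := (hρ σ).2 p hp
    have h4 : p u * σ u ≤ p w * -R := by
      have h5 := mul_le_mul_of_nonneg_left hu.le (hp_pos u).le
      have h6 := mul_le_mul_of_nonneg_right (hw u) (le_max_left 0 ((B + D 0) / p w))
      rw [← hR] at h6
      linarith
    have h5 : B + D 0 ≤ p w * R := by
      rw [← div_le_iff₀' (hp_pos w)]
      exact le_max_right _ _
    have h6 : D σ = expMax P G Finset.univ Finset.univ_nonempty σ - ρ σ ⬝ᵥ σ := rfl
    linarith

open Filter Topology in
/-- Existence of a saddle point: weights whose averaged distribution minimizes `r ⬝ᵥ τ` over `K`. -/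
lemma exists_saddle_point (hG : ∀ u, Integrable (fun ω => G ω u) P)
    (hKs : K ⊆ stdSimplex ℝ V) (hK : IsCompact K) (hKc : Convex ℝ K) (hp : p ∈ K)
    (hp_pos : ∀ u, 0 < p u) :
    ∃ τ, ∃ t ∈ tieWeights V, tieMean (aemeasurable_of_integrable hG) τ t ∈ K ∧
      ∀ r ∈ K, tieMean (aemeasurable_of_integrable hG) τ t ⬝ᵥ τ ≤ r ⬝ᵥ τ := by
  classical
  choose ρ hρK hρ using exists_isMinOn_dotProduct hK hp
  obtain ⟨τ, hτ⟩ := exists_dual_minimizer hG hKs hp hp_pos fun τ => ⟨hρK τ, hρ τ⟩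
  refine ⟨τ, ?_⟩
  set Φ := tieMean (aemeasurable_of_integrable hG) τ with hΦ
  have hΦc : Continuous Φ := Φ.continuous_of_finiteDimensional
  set B : Set (V → ℝ) := K ∩ {r | r ⬝ᵥ τ ≤ ρ τ ⬝ᵥ τ} with hB
  have hdot : ∀ x : V → ℝ, Continuous fun r : V → ℝ => r ⬝ᵥ x := fun x =>
    Continuous.dotProduct continuous_id continuous_const
  have hBclosed : IsClosed B := hK.isClosed.inter (isClosed_le (hdot τ) continuous_const)
  have hBconv : Convex ℝ B := by
    refine hKc.inter fun x hx y hy a b ha hb hab => ?_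
    have h1 := mul_le_mul_of_nonneg_left hx ha
    have h2 := mul_le_mul_of_nonneg_left hy hb
    change (a • x + b • y) ⬝ᵥ τ ≤ ρ τ ⬝ᵥ τ
    rw [add_dotProduct, smul_dotProduct, smul_dotProduct, smul_eq_mul, smul_eq_mul]
    calc a * x ⬝ᵥ τ + b * y ⬝ᵥ τ ≤ a * ρ τ ⬝ᵥ τ + b * ρ τ ⬝ᵥ τ := add_le_add h1 h2
      _ = ρ τ ⬝ᵥ τ := by rw [← add_mul, hab, one_mul]
  by_contra hcon
  have hdisj : Disjoint (Φ '' tieWeights V) B := by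
    rw [Set.disjoint_left]
    rintro _ ⟨t, ht, rfl⟩ ⟨htK, htτ⟩
    exact hcon ⟨t, ht, htK, fun r hr => le_trans htτ (hρ τ r hr)⟩
  obtain ⟨f, a, b, hfa, hab, hfb⟩ := geometric_hahn_banach_compact_closed
    (convex_tieWeights.linear_image Φ) (isCompact_tieWeights.image hΦc) hBconv hBclosed hdisj
  let d : V → ℝ := fun u => f (Pi.single u 1)
  have hfd : ∀ x, f x = x ⬝ᵥ d := by
    intro x
    conv_lhs => rw [pi_eq_sum_univ' x]
    simp [dotProduct, d]
  have hex : ∀ N : Finset V, ∃ c : V, N.Nonempty → c ∈ N ∧ ∀ v ∈ N, d v ≤ d c := by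
    intro N
    by_cases hN : N.Nonempty
    · obtain ⟨c, hc, hcd⟩ := N.exists_max_image d hN
      exact ⟨c, fun _ => ⟨hc, hcd⟩⟩
    · exact ⟨Classical.arbitrary V, fun h => (hN h).elim⟩
  choose c hc using hex
  let t : Finset V → V → ℝ := fun N => Pi.single (c N) 1
  have ht : t ∈ tieWeights V := fun N _ => ⟨single_mem_stdSimplex ℝ (c N), fun hN u hu =>
    Pi.single_eq_of_ne (fun h : u = c N => hu (by rw [h]; exact (hc N hN).1)) _⟩
  have htd : Φ t ⬝ᵥ d = ∫ ω, d (c (maximizers (G ω) τ)) ∂P := by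
    change ∑ u, (∫ ω, t (maximizers (G ω) τ) u ∂P) * d u = _
    simp_rw [← integral_mul_const]
    rw [← integral_finsetSum _ fun u _ => (integrable_comp_maximizers
      (aemeasurable_of_integrable hG) τ fun N => t N u).mul_const _]
    refine integral_congr_ae (ae_of_all _ fun ω => ?_)
    simp [t, Pi.single_apply]
  have hs_pos : ∀ n : ℕ, (0 : ℝ) < 1 / (n + 1) := fun n => Nat.one_div_pos_of_nat
  have hs0 : Tendsto (fun n : ℕ => 1 / ((n : ℝ) + 1)) atTop (𝓝 0) :=
    tendsto_one_div_add_atTop_nhds_zero_nat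
  have hs : Tendsto (fun n : ℕ => 1 / ((n : ℝ) + 1)) atTop (𝓝[>] 0) :=
    tendsto_nhdsWithin_iff.2 ⟨hs0, Eventually.of_forall hs_pos⟩
  have hslope := tendsto_slope_expMax hG Finset.univ_nonempty τ d hc hs hs_pos
  rw [← htd] at hslope
  set r : ℕ → V → ℝ := fun n => ρ (τ + (1 / ((n : ℝ) + 1)) • d) with hr
  have hle : ∀ n, r n ⬝ᵥ d ≤ (expMax P G Finset.univ Finset.univ_nonempty
      (τ + (1 / ((n : ℝ) + 1)) • d) - expMax P G Finset.univ Finset.univ_nonempty τ) /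
        (1 / ((n : ℝ) + 1)) := by
    intro n
    rw [le_div_iff₀ (hs_pos n)]
    have h1 := hτ (τ + (1 / ((n : ℝ) + 1)) • d)
    have h2 := hρ τ (r n) (hρK _)
    change _ ≤ _ - r n ⬝ᵥ _ at h1
    rw [dotProduct_add, dotProduct_smul, smul_eq_mul] at h1
    linarith
  obtain ⟨r₀, hr₀K, φ, hφ, hlim⟩ := hK.tendsto_subseq fun n => hρK (τ + (1 / ((n : ℝ) + 1)) • d)
  have hr₀ : r₀ ∈ B := by
    refine ⟨hr₀K, ?_⟩
    have h1 : Tendsto (fun n => r (φ n) ⬝ᵥ (τ + (1 / ((φ n : ℝ) + 1)) • d)) atTop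
        (𝓝 (r₀ ⬝ᵥ (τ + (0 : ℝ) • d))) := by
      have hcont : Continuous fun x : (V → ℝ) × ℝ => x.1 ⬝ᵥ (τ + x.2 • d) :=
        Continuous.dotProduct continuous_fst
          (continuous_const.add (continuous_snd.smul continuous_const))
      exact (hcont.tendsto (r₀, 0)).comp (hlim.prodMk_nhds (hs0.comp hφ.tendsto_atTop))
    have h2 : Tendsto (fun n => ρ τ ⬝ᵥ (τ + (1 / ((φ n : ℝ) + 1)) • d)) atTop
        (𝓝 (ρ τ ⬝ᵥ (τ + (0 : ℝ) • d))) := by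
      have hcont : Continuous fun x : ℝ => ρ τ ⬝ᵥ (τ + x • d) :=
        Continuous.dotProduct continuous_const
          (continuous_const.add (continuous_id.smul continuous_const))
      exact (hcont.tendsto 0).comp (hs0.comp hφ.tendsto_atTop)
    have h3 := le_of_tendsto_of_tendsto' h1 h2 fun n => hρ _ _ (hρK τ)
    simpa using h3
  have h1 : r₀ ⬝ᵥ d ≤ Φ t ⬝ᵥ d :=
    le_of_tendsto_of_tendsto' (((hdot d).tendsto r₀).comp hlim) (hslope.comp hφ.tendsto_atTop)
      fun n => hle (φ n)
  have h2 := hfa _ ⟨t, ht, rfl⟩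
  have h3 := hfb _ hr₀
  rw [hfd] at h2 h3
  linarith

end Duality

section ArgmaxIndicator

variable {V Ω : Type*}

open Classical in
/-- The indicator of the maximizers of `v ↦ g v + τ v` over `S`. -/
noncomputable def argmaxIndicator (S : Finset V) (τ g : V → ℝ) (u : V) : ℝ :=
  if u ∈ S ∧ ∀ v ∈ S, g v + τ v ≤ g u + τ u then 1 else 0

lemma gumbelMechanism_eq [Fintype V] (p : V → ℝ) (α : ℝ) :
    gumbelMechanism p α = argmaxIndicator Finset.univ fun v => α * Real.log (p v) := by
  ext g u
  simp [gumbelMechanism, argmaxIndicator, maximizers]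

variable {S : Finset V} {τ g : V → ℝ}

lemma argmaxIndicator_nonneg (u : V) : 0 ≤ argmaxIndicator S τ g u := by
  unfold argmaxIndicator
  split_ifs <;> simp

lemma argmaxIndicator_le_one (u : V) : argmaxIndicator S τ g u ≤ 1 := by
  unfold argmaxIndicator
  split_ifs <;> simp

lemma argmaxIndicator_of_notMem {u : V} (hu : u ∉ S) : argmaxIndicator S τ g u = 0 :=
  if_neg fun h => hu h.1

lemma eq_shiftedMax_of_argmaxIndicator_ne_zero (hS : S.Nonempty) {u : V}
    (h : argmaxIndicator S τ g u ≠ 0) : g u + τ u = shiftedMax S hS τ g := by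
  unfold argmaxIndicator at h
  split_ifs at h with h'
  · exact le_antisymm (le_shiftedMax h'.1) (shiftedMax_le_iff.2 h'.2)
  · exact (h rfl).elim

lemma one_le_sum_argmaxIndicator [Fintype V] (hS : S.Nonempty) (τ g : V → ℝ) :
    1 ≤ ∑ u, argmaxIndicator S τ g u := by
  obtain ⟨u, hu, h⟩ := exists_eq_shiftedMax hS τ g
  have h1 : argmaxIndicator S τ g u = 1 :=
    if_pos ⟨hu, fun v hv => (le_shiftedMax hv).trans_eq h.symm⟩
  rw [← h1]
  exact Finset.single_le_sum (fun v _ => argmaxIndicator_nonneg v) (Finset.mem_univ u)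

lemma measurable_argmaxIndicator (S : Finset V) (τ : V → ℝ) :
    Measurable (argmaxIndicator S τ) := by
  refine measurable_pi_iff.2 fun u => Measurable.ite ?_ measurable_const measurable_const
  refine (MeasurableSet.const _).inter ?_
  change MeasurableSet {g : V → ℝ | ∀ v ∈ S, g v + τ v ≤ g u + τ u}
  simp only [ofPred_forall]
  refine Finset.measurableSet_biInter S fun v _ => ?_
  exact measurableSet_le ((measurable_pi_apply v).add_const _) ((measurable_pi_apply u).add_const _)

lemma shiftedMax_add_mul_argmaxIndicator_le [DecidableEq V] (hS : S.Nonempty) (τ g : V → ℝ)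
    (u : V) (s : ℝ) :
    shiftedMax S hS τ g + s * argmaxIndicator S τ g u
      ≤ shiftedMax S hS (τ + s • Pi.single u 1) g := by
  by_cases hu : argmaxIndicator S τ g u = 0
  · obtain ⟨v, hv, h⟩ := exists_eq_shiftedMax hS τ g
    have hvu : v ≠ u := by
      rintro rfl
      have : argmaxIndicator S τ g v = 1 :=
        if_pos ⟨hv, fun w hw => (le_shiftedMax hw).trans_eq h.symm⟩
      simp [this] at hu
    have := le_shiftedMax (hS := hS) (τ := τ + s • Pi.single u 1) (g := g) hv
    rw [hu, ← h]
    simpa [Pi.single_eq_of_ne hvu] using this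
  · have h := eq_shiftedMax_of_argmaxIndicator_ne_zero hS hu
    have huS : u ∈ S := by
      by_contra h'
      exact hu (argmaxIndicator_of_notMem h')
    have h1 : argmaxIndicator S τ g u = 1 := by
      unfold argmaxIndicator at hu ⊢
      split_ifs at hu ⊢
      · rfl
      · exact (hu rfl).elim
    have := le_shiftedMax (hS := hS) (τ := τ + s • Pi.single u 1) (g := g) huS
    rw [h1, ← h]
    simp at this
    linarith

end ArgmaxIndicator

section GumbelScores

variable {V Ω : Type*} [Fintype V] [MeasurableSpace Ω] {P : Measure Ω} [IsProbabilityMeasure P]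
  {G : Ω → V → ℝ}

omit [Fintype V] [IsProbabilityMeasure P] in
lemma integrable_of_hasLaw {L : Measure ℝ} (hL : Integrable (fun x : ℝ => x) L)
    (hG_law : ∀ u, HasLaw (fun ω => G ω u) L P) (u : V) : Integrable (fun ω => G ω u) P := by
  rw [← (hG_law u).map_eq] at hL
  exact hL.comp_aemeasurable (hG_law u).aemeasurable

lemma map_shiftedMax_stdGumbel (hG_indep : iIndepFun (fun u ω => G ω u) P)
    (hG_law : ∀ u, HasLaw (fun ω => G ω u) stdGumbel P) (S : Finset V) (hS : S.Nonempty)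
    (τ : V → ℝ) :
    P.map (fun ω => shiftedMax S hS τ (G ω)) =
      stdGumbel.map fun x => x + Real.log (∑ v ∈ S, Real.exp (τ v)) := by
  have hint := integrable_of_hasLaw integrable_id_stdGumbel hG_law
  have hm := (integrable_shiftedMax hint hS τ).aemeasurable
  have : IsProbabilityMeasure stdGumbel := (hG_law hS.choose).map_eq ▸
    Measure.isProbabilityMeasure_map (hG_law hS.choose).aemeasurable
  have : IsProbabilityMeasure (P.map fun ω => shiftedMax S hS τ (G ω)) :=
    Measure.isProbabilityMeasure_map hm
  refine Measure.ext_of_Iic _ _ fun x => ?_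
  rw [Measure.map_apply_of_aemeasurable hm measurableSet_Iic,
    Measure.map_apply (measurable_add_const _) measurableSet_Iic]
  have h1 : (fun ω => shiftedMax S hS τ (G ω)) ⁻¹' Iic x
      = ⋂ v ∈ S, (fun ω => G ω v) ⁻¹' Iic (x - τ v) := by
    ext ω
    simp [shiftedMax_le_iff, le_sub_iff_add_le]
  have h2 : (fun y => y + Real.log (∑ v ∈ S, Real.exp (τ v))) ⁻¹' Iic x
      = Iic (x - Real.log (∑ v ∈ S, Real.exp (τ v))) := by
    ext y
    simp [le_sub_iff_add_le]
  have hZ : 0 < ∑ v ∈ S, Real.exp (τ v) := Finset.sum_pos (fun v _ => Real.exp_pos _) hS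
  rw [h1, h2, hG_indep.measure_inter_preimage_eq_mul S fun _ _ => measurableSet_Iic]
  have h3 : ∀ v ∈ S, P ((fun ω => G ω v) ⁻¹' Iic (x - τ v))
      = ENNReal.ofReal (Real.exp (-Real.exp (-(x - τ v)))) := fun v _ => by
    rw [← Measure.map_apply_of_aemeasurable (hG_law v).aemeasurable measurableSet_Iic,
      (hG_law v).map_eq, stdGumbel_Iic]
  rw [Finset.prod_congr rfl h3, stdGumbel_Iic,
    ← ENNReal.ofReal_prod_of_nonneg fun _ _ => (Real.exp_pos _).le, ← Real.exp_sum,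
    Finset.sum_neg_distrib]
  simp_rw [neg_sub, Real.exp_sub, Real.exp_log hZ, Finset.sum_div]

lemma expMax_stdGumbel (hG_indep : iIndepFun (fun u ω => G ω u) P)
    (hG_law : ∀ u, HasLaw (fun ω => G ω u) stdGumbel P) (S : Finset V) (hS : S.Nonempty)
    (τ : V → ℝ) :
    expMax P G S hS τ =
      Real.eulerMascheroniConstant + Real.log (∑ v ∈ S, Real.exp (τ v)) := by
  have hint := integrable_of_hasLaw integrable_id_stdGumbel hG_law
  have hm := (integrable_shiftedMax hint hS τ).aemeasurable
  have : IsProbabilityMeasure stdGumbel := (hG_law hS.choose).map_eq ▸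
    Measure.isProbabilityMeasure_map (hG_law hS.choose).aemeasurable
  calc expMax P G S hS τ = ∫ x, x ∂P.map (fun ω => shiftedMax S hS τ (G ω)) :=
        (integral_map hm aestronglyMeasurable_id).symm
    _ = ∫ x, (x + Real.log (∑ v ∈ S, Real.exp (τ v))) ∂stdGumbel := by
        rw [map_shiftedMax_stdGumbel hG_indep hG_law S hS τ]
        exact integral_map (measurable_id.add_const _).aemeasurable aestronglyMeasurable_id
    _ = _ := by
        rw [integral_add integrable_id_stdGumbel (integrable_const _), integral_id_stdGumbel]
        simp

omit [Fintype V] in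
lemma integrable_argmaxIndicator (hG : AEMeasurable G P) (S : Finset V) (τ : V → ℝ) (u : V) :
    Integrable (fun ω => argmaxIndicator S τ (G ω) u) P :=
  Integrable.of_bound (C := 1)
    ((measurable_pi_iff.1 (measurable_argmaxIndicator S τ) u).comp_aemeasurable
      hG).aestronglyMeasurable
    (ae_of_all _ fun ω => by
      rw [Real.norm_of_nonneg (argmaxIndicator_nonneg u)]
      exact argmaxIndicator_le_one u)

/-- The Gumbel-max trick: the maximizer over `S` is distributed proportionally to `exp τ`. -/
lemma mean_argmaxIndicator (hG_indep : iIndepFun (fun u ω => G ω u) P)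
    (hG_law : ∀ u, HasLaw (fun ω => G ω u) stdGumbel P) (S : Finset V) (hS : S.Nonempty)
    (τ : V → ℝ) {u : V} (hu : u ∈ S) :
    mean P G (argmaxIndicator S τ) u = Real.exp (τ u) / ∑ v ∈ S, Real.exp (τ v) := by
  classical
  have hint := integrable_of_hasLaw integrable_id_stdGumbel hG_law
  have hG := aemeasurable_of_integrable hint
  have hZ : 0 < ∑ v ∈ S, Real.exp (τ v) := Finset.sum_pos (fun v _ => Real.exp_pos _) hS
  set m := mean P G (argmaxIndicator S τ) u with hm
  let f : ℝ → ℝ := fun s =>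
    Real.log (∑ v ∈ S, Real.exp (τ v + s * (Pi.single u 1 : V → ℝ) v)) - s * m
  have hf : ∀ s, f 0 ≤ f s := by
    intro s
    have h : expMax P G S hS τ + s * m ≤ expMax P G S hS (τ + s • Pi.single u 1) := by
      rw [hm, mean, ← integral_const_mul, expMax, ← integral_add
        (integrable_shiftedMax hint hS τ) ((integrable_argmaxIndicator hG S τ u).const_mul s)]
      exact integral_mono ((integrable_shiftedMax hint hS τ).add
        ((integrable_argmaxIndicator hG S τ u).const_mul s)) (integrable_shiftedMax hint hS _)
        fun ω => shiftedMax_add_mul_argmaxIndicator_le hS τ (G ω) u s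
    rw [expMax_stdGumbel hG_indep hG_law, expMax_stdGumbel hG_indep hG_law] at h
    simp only [f, zero_mul, add_zero, sub_zero]
    simp only [Pi.add_apply, Pi.smul_apply, smul_eq_mul] at h
    linarith
  have hd : HasDerivAt f (Real.exp (τ u) / (∑ v ∈ S, Real.exp (τ v)) - m) 0 := by
    have h1 : HasDerivAt (fun s => ∑ v ∈ S, Real.exp (τ v + s * (Pi.single u 1 : V → ℝ) v))
        (∑ v ∈ S, Real.exp (τ v + 0 * (Pi.single u 1 : V → ℝ) v) *
          (1 * (Pi.single u 1 : V → ℝ) v)) 0 :=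
      HasDerivAt.fun_sum fun v _ => (((hasDerivAt_id 0).mul_const _).const_add _).exp
    have h2 := (h1.log (by simpa using hZ.ne')).sub ((hasDerivAt_id (0 : ℝ)).mul_const m)
    refine h2.congr_deriv ?_
    simp [Pi.single_apply, hu]
  have := IsLocalMin.hasDerivAt_eq_zero (Filter.Eventually.of_forall hf) hd
  linarith

lemma isMechanism_argmaxIndicator (hG_indep : iIndepFun (fun u ω => G ω u) P)
    (hG_law : ∀ u, HasLaw (fun ω => G ω u) stdGumbel P) (S : Finset V) (hS : S.Nonempty)
    (τ : V → ℝ) : IsMechanism P G (argmaxIndicator S τ) := by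
  refine ⟨measurable_argmaxIndicator S τ, ?_⟩
  have hint := integrable_of_hasLaw integrable_id_stdGumbel hG_law
  have hi := integrable_argmaxIndicator (aemeasurable_of_integrable hint) S τ
  have hZ : 0 < ∑ v ∈ S, Real.exp (τ v) := Finset.sum_pos (fun v _ => Real.exp_pos _) hS
  have hsum : ∫ ω, (∑ u, argmaxIndicator S τ (G ω) u - 1) ∂P = 0 := by
    have h1 : ∑ u, mean P G (argmaxIndicator S τ) u = 1 := by
      rw [← Finset.sum_subset (Finset.subset_univ S) fun u _ hu => by
        simp [mean, argmaxIndicator_of_notMem hu],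
        Finset.sum_congr rfl fun u hu => mean_argmaxIndicator hG_indep hG_law S hS τ hu,
        ← Finset.sum_div, div_self hZ.ne']
    rw [integral_sub (integrable_finsetSum _ fun u _ => hi u) (integrable_const _),
      integral_finsetSum _ fun u _ => hi u]
    simp only [mean] at h1
    rw [h1]
    simp
  have h0 := (integral_eq_zero_iff_of_nonneg
    (fun ω => sub_nonneg.2 (one_le_sum_argmaxIndicator hS τ (G ω)))
    ((integrable_finsetSum _ fun u _ => hi u).sub (integrable_const _))).1 hsum
  filter_upwards [h0] with ω hω
  exact ⟨fun u => argmaxIndicator_nonneg u, sub_eq_zero.1 hω⟩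

lemma score_argmaxIndicator (hG_indep : iIndepFun (fun u ω => G ω u) P)
    (hG_law : ∀ u, HasLaw (fun ω => G ω u) stdGumbel P) (S : Finset V) (hS : S.Nonempty)
    (τ : V → ℝ) :
    score P G (argmaxIndicator S τ) + ∑ u, mean P G (argmaxIndicator S τ) u * τ u =
      Real.eulerMascheroniConstant + Real.log (∑ v ∈ S, Real.exp (τ v)) := by
  rw [← expMax_stdGumbel hG_indep hG_law S hS τ]
  exact (isMechanism_argmaxIndicator hG_indep hG_law S hS τ).score_add_eq
    (integrable_of_hasLaw integrable_id_stdGumbel hG_law) hS τ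
    (ae_of_all _ fun ω u hu => eq_shiftedMax_of_argmaxIndicator_ne_zero hS hu)

/-- The best score of a mechanism with averaged distribution `r` is `γ + H(r)`. -/
lemma isGreatest_score_stdGumbel (hG_indep : iIndepFun (fun u ω => G ω u) P)
    (hG_law : ∀ u, HasLaw (fun ω => G ω u) stdGumbel P) {r : V → ℝ} (hr : r ∈ stdSimplex ℝ V) :
    IsGreatest {s : ℝ | ∃ q, IsMechanism P G q ∧ mean P G q = r ∧ score P G q = s}
      (Real.eulerMascheroniConstant + entropy r) := by
  classical
  let S : Finset V := Finset.univ.filter fun u => r u ≠ 0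
  have hmem : ∀ {u}, u ∈ S ↔ r u ≠ 0 := by simp [S]
  have hpos : ∀ u ∈ S, 0 < r u := fun u hu => (hr.1 u).lt_of_ne' (hmem.1 hu)
  have hsumS : ∑ u ∈ S, r u = 1 := by
    rw [← hr.2]
    exact Finset.sum_filter_ne_zero _
  have hS : S.Nonempty := by
    rw [Finset.nonempty_iff_ne_empty]
    intro h
    simp [h] at hsumS
  let τ : V → ℝ := fun u => Real.log (r u)
  have hexp : ∀ u ∈ S, Real.exp (τ u) = r u := fun u hu => Real.exp_log (hpos u hu)
  have hZ : ∑ u ∈ S, Real.exp (τ u) = 1 := (Finset.sum_congr rfl hexp).trans hsumS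
  constructor
  · have hmean : mean P G (argmaxIndicator S τ) = r := by
      ext u
      by_cases hu : u ∈ S
      · rw [mean_argmaxIndicator hG_indep hG_law S hS τ hu, hZ, hexp u hu, div_one]
      · rw [not_not.1 (mt hmem.2 hu)]
        simp [mean, argmaxIndicator_of_notMem hu]
    refine ⟨_, isMechanism_argmaxIndicator hG_indep hG_law S hS τ, hmean, ?_⟩
    have h := score_argmaxIndicator hG_indep hG_law S hS τ
    rw [hmean, hZ, Real.log_one] at h
    rw [entropy]
    linarith
  · rintro _ ⟨q, hq, hmean, rfl⟩
    have h := hq.score_add_le (integrable_of_hasLaw integrable_id_stdGumbel hG_law) hS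
      (fun u hu => by rw [hmean, not_not.1 (mt hmem.2 hu)]) τ
    rw [expMax_stdGumbel hG_indep hG_law, hZ, Real.log_one, hmean] at h
    rw [entropy]
    linarith

variable [Nonempty V] {p : V → ℝ}

omit [Nonempty V] in
lemma exp_mul_log {x : ℝ} (hx : 0 < x) (α : ℝ) : Real.exp (α * Real.log x) = x ^ α := by
  rw [Real.rpow_def_of_pos hx, mul_comm]

lemma isMechanism_gumbelMechanism (hG_indep : iIndepFun (fun u ω => G ω u) P)
    (hG_law : ∀ u, HasLaw (fun ω => G ω u) stdGumbel P) (α : ℝ) :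
    IsMechanism P G (gumbelMechanism p α) := by
  rw [gumbelMechanism_eq]
  exact isMechanism_argmaxIndicator hG_indep hG_law _ Finset.univ_nonempty _

lemma mean_gumbelMechanism (hG_indep : iIndepFun (fun u ω => G ω u) P)
    (hG_law : ∀ u, HasLaw (fun ω => G ω u) stdGumbel P) (hp : ∀ u, 0 < p u) (α : ℝ) :
    mean P G (gumbelMechanism p α) = powerDist p α := by
  ext u
  rw [gumbelMechanism_eq, mean_argmaxIndicator hG_indep hG_law _ Finset.univ_nonempty _
    (Finset.mem_univ u)]
  simp_rw [exp_mul_log (hp _), powerDist]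

lemma score_gumbelMechanism (hG_indep : iIndepFun (fun u ω => G ω u) P)
    (hG_law : ∀ u, HasLaw (fun ω => G ω u) stdGumbel P) (hp : ∀ u, 0 < p u) (α : ℝ) :
    score P G (gumbelMechanism p α) =
      Real.eulerMascheroniConstant + entropy (powerDist p α) := by
  have h := score_argmaxIndicator hG_indep hG_law _ Finset.univ_nonempty
    fun v => α * Real.log (p v)
  rw [← gumbelMechanism_eq, mean_gumbelMechanism hG_indep hG_law hp] at h
  simp_rw [exp_mul_log (hp _)] at h
  have h1 : entropy (powerDist p α) = Real.log (∑ v, p v ^ α)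
      - ∑ u, powerDist p α u * (α * Real.log (p u)) := by
    simp_rw [entropy, log_powerDist hp, mul_sub]
    rw [Finset.sum_sub_distrib, ← Finset.sum_mul, (powerDist_mem_stdSimplex hp α).2]
    ring
  linarith

lemma isOptimal_gumbelMechanism (hG_indep : iIndepFun (fun u ω => G ω u) P)
    (hG_law : ∀ u, HasLaw (fun ω => G ω u) stdGumbel P) (hp : ∀ u, 0 < p u) {α ε : ℝ}
    (hkl : kl (powerDist p α) p ≤ ε)
    (hmax : ∀ r ∈ stdSimplex ℝ V, kl r p ≤ ε → r ≠ powerDist p α →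
      entropy r < entropy (powerDist p α)) :
    IsOptimal P G p ε (gumbelMechanism p α) := by
  refine ⟨⟨isMechanism_gumbelMechanism hG_indep hG_law α, ?_⟩, fun q hq => ?_⟩
  · rwa [mean_gumbelMechanism hG_indep hG_law hp]
  · have hr := hq.1.mean_mem_stdSimplex
      (aemeasurable_of_integrable (integrable_of_hasLaw integrable_id_stdGumbel hG_law))
    have h1 := (isGreatest_score_stdGumbel hG_indep hG_law hr).2 ⟨q, hq.1, rfl, rfl⟩
    rw [score_gumbelMechanism hG_indep hG_law hp]
    have h2 : entropy (mean P G q) ≤ entropy (powerDist p α) := by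
      by_cases h : mean P G q = powerDist p α
      · rw [h]
      · exact (hmax _ hr hq.2 h).le
    linarith

end GumbelScores

section ExistenceOfOptimum

variable {V Ω : Type*} [Fintype V] [Nonempty V] [MeasurableSpace Ω] {P : Measure Ω}
  [IsProbabilityMeasure P] {G : Ω → V → ℝ} {p : V → ℝ} {ε : ℝ}

lemma IsTieBreak.isOptimal_of_zero (hG : ∀ u, Integrable (fun ω => G ω u) P)
    {T : (V → ℝ) → V → ℝ} (hT : IsTieBreak 0 T)
    (hkl : kl (mean P G (argmaxMechanism 0 T)) p ≤ ε) :
    IsOptimal P G p ε (argmaxMechanism 0 T) :=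
  hT.isOptimal hG hkl fun r _ => by simp

omit [Nonempty V] in
/-- Interpolating between tie-breaking rules makes the divergence constraint active. -/
lemma IsTieBreak.exists_kl_eq (hG : AEMeasurable G P) (hp_pos : ∀ u, 0 < p u) {τ : V → ℝ}
    {T T' : (V → ℝ) → V → ℝ} (hT : IsTieBreak τ T) (hT' : IsTieBreak τ T')
    (h : ε ≤ kl (mean P G (argmaxMechanism τ T)) p)
    (h' : kl (mean P G (argmaxMechanism τ T')) p ≤ ε) :
    ∃ T'', IsTieBreak τ T'' ∧ kl (mean P G (argmaxMechanism τ T'')) p = ε := by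
  classical
  let r : ℝ → V → ℝ := fun s =>
    (1 - s) • mean P G (argmaxMechanism τ T) + s • mean P G (argmaxMechanism τ T')
  have hr : Continuous r := by fun_prop
  have hc : ContinuousOn (fun s => kl (r s) p) (Icc 0 1) :=
    ((continuous_kl hp_pos).comp hr).continuousOn
  obtain ⟨s, hs, hks⟩ := intermediate_value_Icc' zero_le_one hc (by simpa [r] using ⟨h', h⟩)
  have hTs := hT.convexCombination hT' hs
  refine ⟨_, hTs, ?_⟩
  rw [← hks]
  congr 1
  ext u
  simp only [r, mean, Pi.add_apply, Pi.smul_apply, smul_eq_mul]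
  rw [← integral_const_mul, ← integral_const_mul, ← integral_add
    ((hT.isMechanism.integrable hG u).const_mul _) ((hT'.isMechanism.integrable hG u).const_mul _)]
  refine integral_congr_ae (ae_of_all _ fun ω => ?_)
  simp only [hTs.argmaxMechanism_apply, hT.argmaxMechanism_apply, hT'.argmaxMechanism_apply]
  split_ifs <;> simp

omit [Nonempty V] in
/-- A linear functional minimized over a divergence ball at an interior point is minimized there
over the whole simplex. -/
lemma dotProduct_le_of_kl_lt (hp_pos : ∀ u, 0 < p u) {r τ : V → ℝ} (hr : r ∈ stdSimplex ℝ V)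
    (hkl : kl r p < ε) (hmin : ∀ r' ∈ klBall p ε, r ⬝ᵥ τ ≤ r' ⬝ᵥ τ) {x : V → ℝ}
    (hx : x ∈ stdSimplex ℝ V) : r ⬝ᵥ τ ≤ x ⬝ᵥ τ := by
  let y : ℝ → V → ℝ := fun s => (1 - s) • r + s • x
  have hy : Continuous y := by fun_prop
  have h1 : ∀ᶠ s in nhds (0 : ℝ), kl (y s) p < ε :=
    (((continuous_kl hp_pos).comp hy).tendsto 0).eventually_lt_const (by simpa [y] using hkl)
  have h2 : ∀ᶠ s in nhdsWithin (0 : ℝ) (Ioi 0), kl (y s) p < ε :=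
    h1.filter_mono nhdsWithin_le_nhds
  obtain ⟨s, hs, hs01⟩ := (h2.and (Ioo_mem_nhdsGT one_pos)).exists
  have h3 := hmin (y s) ⟨convex_stdSimplex ℝ V hr hx (sub_nonneg.2 hs01.2.le) hs01.1.le (by ring),
    hs.le⟩
  simp only [y, add_dotProduct, smul_dotProduct, smul_eq_mul] at h3
  refine le_of_mul_le_mul_left ?_ hs01.1
  linarith

/-- A mechanism attaining the unconstrained maximum is almost surely an argmax mechanism. -/
lemma IsMechanism.exists_isTieBreak_zero (hG : ∀ u, Integrable (fun ω => G ω u) P)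
    {q : (V → ℝ) → V → ℝ} (hq : IsMechanism P G q)
    (hscore : expMax P G Finset.univ Finset.univ_nonempty 0 ≤ score P G q) :
    ∃ T, IsTieBreak 0 T ∧ mean P G (argmaxMechanism 0 T) = mean P G q := by
  classical
  let m : (V → ℝ) → ℝ := fun g => ∑ u, if u ∈ maximizers g 0 then q g u else 0
  let good : Set (V → ℝ) := {g | (∀ u, q g u ∈ Icc (0 : ℝ) 1) ∧ m g = 1}
  let T : (V → ℝ) → V → ℝ := fun g => if g ∈ good then q g else uniformTieBreak 0 g
  have hqm : ∀ u, Measurable fun g => q g u := measurable_pi_iff.1 hq.1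
  have hm : Measurable m := Finset.measurable_fun_sum _ fun u _ =>
    Measurable.ite (measurableSet_mem_maximizers 0 u) (hqm u) measurable_const
  have hgood : MeasurableSet good := by
    refine MeasurableSet.inter ?_ (measurableSet_eq_fun hm measurable_const)
    change MeasurableSet {g : V → ℝ | ∀ u, q g u ∈ Icc (0 : ℝ) 1}
    simp only [ofPred_forall]
    exact MeasurableSet.iInter fun u => hqm u measurableSet_Icc
  have huni := isTieBreak_uniformTieBreak (0 : V → ℝ)
  have hT : IsTieBreak 0 T := by
    refine ⟨Measurable.ite hgood hq.1 huni.1, fun g u => ?_, fun g => ?_⟩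
    · by_cases hg : g ∈ good
      · simpa [T, hg] using hg.1 u
      · simpa [T, hg] using huni.2.1 g u
    · by_cases hg : g ∈ good
      · have h := hg.2
        simp only [m, Finset.sum_ite_mem, Finset.univ_inter] at h
        simpa [T, hg] using h
      · simpa [T, hg] using huni.2.2 g
  refine ⟨T, hT, ?_⟩
  have hi1 := integrable_shiftedMax hG Finset.univ_nonempty 0
  have hi2 := hq.integrable_sum hG 0
  have hle : ∀ᵐ ω ∂P, 0 ≤ shiftedMax Finset.univ Finset.univ_nonempty 0 (G ω) -
      ∑ u, (G ω u + (0 : V → ℝ) u) * q (G ω) u := by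
    filter_upwards [hq.2] with ω hω
    exact sub_nonneg.2 (mul_sum_le_shiftedMax hω fun u hu => (hu (Finset.mem_univ u)).elim)
  have hzero : ∫ ω, (shiftedMax Finset.univ Finset.univ_nonempty 0 (G ω) -
      ∑ u, (G ω u + (0 : V → ℝ) u) * q (G ω) u) ∂P = 0 := by
    refine le_antisymm ?_ (integral_nonneg_of_ae hle)
    rw [integral_sub hi1 hi2, ← hq.score_add hG 0]
    simpa [expMax] using hscore
  have hae := (integral_eq_zero_iff_of_nonneg_ae hle (hi1.sub hi2)).1 hzero
  ext u
  refine integral_congr_ae ?_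
  filter_upwards [hq.2, hae] with ω hω hω0
  have hsupp : ∀ v, v ∉ maximizers (G ω) 0 → q (G ω) v = 0 := by
    have h1 : ∑ v, (shiftedMax Finset.univ Finset.univ_nonempty 0 (G ω) -
        (G ω v + (0 : V → ℝ) v)) * q (G ω) v = 0 := by
      simp_rw [sub_mul]
      rw [Finset.sum_sub_distrib, ← Finset.mul_sum, hω.2, mul_one]
      exact hω0
    rw [Finset.sum_eq_zero_iff_of_nonneg fun v _ =>
      mul_nonneg (sub_nonneg.2 (le_shiftedMax (Finset.mem_univ v))) (hω.1 v)] at h1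
    intro v hv
    refine (mul_eq_zero.1 (h1 v (Finset.mem_univ v))).resolve_left fun h => hv ?_
    exact (mem_maximizers_iff_eq_shiftedMax Finset.univ_nonempty).2 (sub_eq_zero.1 h).symm
  have hmem : G ω ∈ good := by
    refine ⟨fun v => ⟨hω.1 v, ?_⟩, ?_⟩
    · rw [← hω.2]
      exact Finset.single_le_sum (fun w _ => hω.1 w) (Finset.mem_univ v)
    · rw [← hω.2]
      refine Finset.sum_congr rfl fun v _ => ?_
      split_ifs with h
      exacts [rfl, (hsupp v h).symm]
  rw [hT.argmaxMechanism_apply]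
  split_ifs with h
  · simp [T, hmem]
  · exact (hsupp u h).symm

lemma exists_isOptimal_argmaxMechanism (hG : ∀ u, Integrable (fun ω => G ω u) P)
    (hp : p ∈ stdSimplex ℝ V) (hp_pos : ∀ u, 0 < p u) (hε : 0 ≤ ε) :
    ∃ (τ : V → ℝ) (T : (V → ℝ) → V → ℝ), IsTieBreak τ T ∧
      IsOptimal P G p ε (argmaxMechanism τ T) ∧
      (¬ IsFeasible P G p ε (argmaxMechanism 0 (uniformTieBreak 0)) →
        kl (mean P G (argmaxMechanism τ T)) p = ε) ∧
      ((∃ T₀, IsTieBreak 0 T₀ ∧ IsFeasible P G p ε (argmaxMechanism 0 T₀)) → τ = 0) := by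
  have hGm := aemeasurable_of_integrable hG
  have huni := isTieBreak_uniformTieBreak (0 : V → ℝ)
  by_cases hzero : ∃ T₀, IsTieBreak 0 T₀ ∧ IsFeasible P G p ε (argmaxMechanism 0 T₀)
  · by_cases hfeas : IsFeasible P G p ε (argmaxMechanism 0 (uniformTieBreak 0))
    · exact ⟨0, _, huni, huni.isOptimal_of_zero hG hfeas.2, fun h => (h hfeas).elim, fun _ => rfl⟩
    · obtain ⟨T₀, hT₀, hf₀⟩ := hzero
      have hlt : ε < kl (mean P G (argmaxMechanism 0 (uniformTieBreak 0))) p :=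
        not_le.1 fun h => hfeas ⟨huni.isMechanism, h⟩
      obtain ⟨T, hT, hkl⟩ := huni.exists_kl_eq hGm hp_pos hT₀ hlt.le hf₀.2
      exact ⟨0, T, hT, hT.isOptimal_of_zero hG hkl.le, fun _ => hkl, fun _ => rfl⟩
  · obtain ⟨τ, t, ht, hK, hmin⟩ := exists_saddle_point hG (fun r hr => hr.1)
      (isCompact_klBall hp_pos ε) (convex_klBall hp_pos ε) (self_mem_klBall hp hp_pos hε) hp_pos
    have hT := isTieBreak_of_mem_tieWeights ht τ
    have hmean : tieMean hGm τ t =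
        mean P G (argmaxMechanism τ fun g => t (maximizers g τ)) := by
      rw [argmaxMechanism_of_mem_tieWeights ht]
      rfl
    rw [hmean] at hK hmin
    refine ⟨τ, _, hT, hT.isOptimal hG hK.2 hmin, fun _ => ?_, fun h => (hzero h).elim⟩
    by_contra hne
    obtain ⟨u, hu⟩ := Finite.exists_min τ
    classical
    have h1 := dotProduct_le_of_kl_lt hp_pos hK.1 (hK.2.lt_of_ne hne) hmin
      (single_mem_stdSimplex ℝ u)
    rw [single_one_dotProduct] at h1
    have h2 := hT.score_add_eq hG Finset.univ_nonempty
    have h3 : expMax P G Finset.univ Finset.univ_nonempty 0 + τ u ≤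
        expMax P G Finset.univ Finset.univ_nonempty τ := by
      have h : ∫ ω, (shiftedMax Finset.univ Finset.univ_nonempty 0 (G ω) + τ u) ∂P =
          expMax P G Finset.univ Finset.univ_nonempty 0 + τ u := by
        rw [integral_add (integrable_shiftedMax hG _ 0) (integrable_const _)]
        simp [expMax]
      rw [← h]
      refine integral_mono ((integrable_shiftedMax hG _ 0).add (integrable_const _))
        (integrable_shiftedMax hG _ τ) fun ω => ?_
      obtain ⟨v, hv, hv'⟩ := exists_eq_shiftedMax Finset.univ_nonempty 0 (G ω)
      have := le_shiftedMax (hS := Finset.univ_nonempty) (τ := τ) (g := G ω) hv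
      simp only [← hv', Pi.zero_apply, add_zero]
      linarith [hu v]
    obtain ⟨T₀, hT₀, hmean₀⟩ := hT.isMechanism.exists_isTieBreak_zero hG (by linarith)
    exact hzero ⟨T₀, hT₀, hT₀.isMechanism, hmean₀ ▸ hK.2⟩

end ExistenceOfOptimum

end Watermark

theorem mainTheorem3 {V Ω : Type*} [Fintype V] [MeasurableSpace Ω]
    (P : Measure Ω) [IsProbabilityMeasure P]
    (p : V → ℝ) (hp : p ∈ stdSimplex ℝ V) (hp_pos : ∀ u, 0 < p u)
    (ε : ℝ) (hε : 0 ≤ ε)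
    (L : Measure ℝ) (G : Ω → V → ℝ)
    (hG_indep : iIndepFun (fun u ω => G ω u) P)
    (hG_law : ∀ u, HasLaw (fun ω => G ω u) L P) :
    -- general score law with finite first moment
    (Integrable (fun x : ℝ => x) L →
      ∃ (τ : V → ℝ) (T : (V → ℝ) → V → ℝ),
        Watermark.IsTieBreak τ T ∧
        Watermark.IsOptimal P G p ε (Watermark.argmaxMechanism τ T) ∧
        -- the constraint is active, unless the uniform argmax mechanism for `τ = 0` is feasible
        (¬ Watermark.IsFeasible P G p ε
            (Watermark.argmaxMechanism 0 (Watermark.uniformTieBreak 0)) →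
          Watermark.kl (Watermark.mean P G (Watermark.argmaxMechanism τ T)) p = ε) ∧
        -- `τ = 0` is used as soon as it is feasible with some tie-breaking rule
        ((∃ T₀, Watermark.IsTieBreak 0 T₀ ∧
            Watermark.IsFeasible P G p ε (Watermark.argmaxMechanism 0 T₀)) → τ = 0)) ∧
    -- standard Gumbel scores
    (L = Watermark.stdGumbel →
      (∃ α ∈ Set.Icc (0 : ℝ) 1,
        Watermark.IsOptimal P G p ε (Watermark.gumbelMechanism p α) ∧
        -- calibration of `α`
        ((∃ β ∈ Set.Icc (0 : ℝ) 1,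
            Watermark.kl (Watermark.mean P G (Watermark.gumbelMechanism p β)) p = ε) →
          Watermark.kl (Watermark.mean P G (Watermark.gumbelMechanism p α)) p = ε) ∧
        ((¬ ∃ β ∈ Set.Icc (0 : ℝ) 1,
            Watermark.kl (Watermark.mean P G (Watermark.gumbelMechanism p β)) p = ε) →
          α = 0) ∧
        -- without distortion one gets the Gumbel-max mechanism `argmax (G v + log (p v))`
        (ε = 0 → α = 1) ∧
        -- the averaged distribution is `∝ p ^ α` and is the unique entropy maximizer
        Watermark.mean P G (Watermark.gumbelMechanism p α) = Watermark.powerDist p α ∧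
        Watermark.powerDist p α ∈ stdSimplex ℝ V ∧
        Watermark.kl (Watermark.powerDist p α) p ≤ ε ∧
        (∀ r ∈ stdSimplex ℝ V, Watermark.kl r p ≤ ε → r ≠ Watermark.powerDist p α →
          Watermark.entropy r < Watermark.entropy (Watermark.powerDist p α))) ∧
      -- reduction: the best score with averaged distribution `r` is `γ + H(r)`
      (∀ r ∈ stdSimplex ℝ V,
        IsGreatest {s : ℝ | ∃ q, Watermark.IsMechanism P G q ∧ Watermark.mean P G q = r ∧
            Watermark.score P G q = s}
          (Real.eulerMascheroniConstant + Watermark.entropy r))) := by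
  have : Nonempty V := Watermark.nonempty_of_mem_stdSimplex hp
  refine ⟨fun hL => Watermark.exists_isOptimal_argmaxMechanism
    (Watermark.integrable_of_hasLaw hL hG_law) hp hp_pos hε, ?_⟩
  rintro rfl
  refine ⟨?_, fun r hr => Watermark.isGreatest_score_stdGumbel hG_indep hG_law hr⟩
  obtain ⟨α, hα, h1, h2, h3, h4, h5⟩ := Watermark.exists_calibrated_exponent hp hp_pos hε
  simp_rw [Watermark.mean_gumbelMechanism hG_indep hG_law hp_pos]
  exact ⟨α, hα, Watermark.isOptimal_gumbelMechanism hG_indep hG_law hp_pos h4 h5, h1, h2, h3, trivial,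
    Watermark.powerDist_mem_stdSimplex hp_pos α, h4, h5⟩
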